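/- Let $S^5\to\mathbb{C}P^2$ be the Hopf fibration, $Z\cdot\overline W=\sum_k z_k\overline{w_k}$ on $\mathbb{C}^3$, $z=x+iy\in\mathbb{C}$. Let $f:\mathbb{C}\to\mathbb{C}P^2$ be a smooth conformal minimal Lagrangian immersion with induced metric $2e^{u}\,dz\,d\bar z$ (Fubini–Study metric of holomorphic sectional curvature $4$), which is translationally equivariant: $f(t+z)=R(t)f(z)$ for all $t\in\mathbb{R}$, $z\in\mathbb{C}$, with a one-parameter subgroup $R$ of $SU(3)$. Let $\lambda\in S^1$ and write the Hopf differential $(F_{zz}\cdot\overline{F_{\bar z}})\,dz^3$ of $f$ ($F$ a horizontal lift to $S^5$) as $-i\lambda^{-3}\psi\,dz^3$. Assume that $f$ is neither totally geodesic nor flat, that is, $\psi\not\equiv0$ and $u$ is not constant, that the origin is chosen so that $u$ attains its maximum at $0$, and that the cubic form $\lambda^{-3}\psi$ is real. Then $\psi$ is constant. Put $$a_1=e^{u(0)},\quad \beta=2a_1+\frac{|\psi|^2}{a_1^2},\quad s=\frac{\beta}{2}-a_1,\quad a_2=\frac{s+\sqrt{s^2+4a_1s}}{2},\quad a_3=\frac{-s+\sqrt{s^2+4a_1s}}{2},$$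 $$k=\sqrt{\frac{a_1-a_2}{a_1+a_3}},\quad r=\sqrt{2(a_1+a_3)},\quad T=\frac{K(k)}{r},\qquad d_1=\frac{\lambda^{-3}\psi}{a_1},\quad d_2=\frac{\lambda^{-3}\psi}{a_2},\quad d_3=-\frac{\lambda^{-3}\psi}{a_3},$$ $$c_1=a_1\sqrt{\frac{a_1-a_2}{a_1^3-|\psi|^2}},\quad c_2=a_2\sqrt{\frac{a_1-a_2}{|\psi|^2-a_2^3}},\quad c_3=a_3\sqrt{\frac{a_1+a_3}{|\psi|^2+a_3^3}},$$ where $K(k)=\int_0^{\pi/2}(1-k^2\sin^2\alpha)^{-1/2}d\alpha$ and $\mathrm{sn},\mathrm{cn},\mathrm{dn}$ denote the Jacobi elliptic functions. Let $$D(\lambda)=\begin{pmatrix}0&-i\lambda\bar\psi a_1^{-1}&i\lambda^{-1}a_1^{1/2}\\-i\lambda^{-1}\psi a_1^{-1}&0&i\lambda a_1^{1/2}\\ i\lambda a_1^{1/2}&i\lambda^{-1}a_1^{1/2}&0\end{pmatrix}.$$ The canonical horizontal lift of $f$ is $F=\mathbb{F}e_3$, where $\mathbb{F}:\mathbb{C}\to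 SU(3)$ is smooth with $\mathbb{F}(0)=I$, $$\mathbb{F}^{-1}\mathbb{F}_z=\begin{pmatrix}\frac{u_z}{2}&0&i\lambda^{-1}e^{u/2}\\-i\lambda^{-1}\psi e^{-u}&-\frac{u_z}{2}&0\\0&i\lambda^{-1}e^{u/2}&0\end{pmatrix},\qquad \mathbb{F}^{-1}\mathbb{F}_{\bar z}=\begin{pmatrix}-\frac{u_{\bar z}}{2}&-i\lambda\bar\psi e^{-u}&0\\0&\frac{u_{\bar z}}{2}&i\lambda e^{u/2}\\i\lambda e^{u/2}&0&0\end{pmatrix},$$ and $f=A[F]$ for some $A\in SU(3)$ (that is, $f=[F]$ up to an isometry of $\mathbb{C}P^2$). **Theorem.** The canonical horizontal lift exists, and there is an orthonormal basis $l_1,l_2,l_3$ of $\mathbb{C}^3$ with $D(\lambda)l_j=id_jl_j$ such that for all $x,y\in\mathbb{R}$ $$F(x,y)=c_1\,\mathrm{sn}(ry,k)\,e^{id_1x}\,l_1+c_2\,\mathrm{cn}(ry,k)\,e^{id_2x}\,l_2+c_3\,\mathrm{dn}(ry,k)\,e^{id_3x}\,l_3 .$$ It satisfies $F(x,y+4T)=F(x,y)$.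 In particular $T>0$ and $f$ descends to the cylinder $\mathbb{C}/4Ti\mathbb{Z}$. If a real number $\tau\neq0$ satisfies $f(x+\tau,y)=f(x,y)$ for all $x,y$, then $e^{id_1\tau}=e^{id_2\tau}=e^{id_3\tau}$, and $f$ descends to the torus $\mathbb{C}/(4Ti\mathbb{Z}+\tau\mathbb{Z})$ (the numbers $4Ti$ and $\tau$ being linearly independent over $\mathbb{R}$). Such a $\tau$ exists if and only if $d_1/d_2$ is rational. -/

import Mathlib

open scoped Matrix ContDiff LinearAlgebra.Projectivization

namespace MinLag

noncomputable section

/-- `∂/∂z = (∂/∂x - i ∂/∂y) / 2` on functions of `z = x + i y`. -/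
def dz {E : Type*} [NormedAddCommGroup E] [NormedSpace ℂ E] (G : ℂ → E) (z : ℂ) : E :=
  (1 / 2 : ℂ) • (fderiv ℝ G z 1 - Complex.I • fderiv ℝ G z Complex.I)

/-- `∂/∂z̄ = (∂/∂x + i ∂/∂y) / 2` on functions of `z = x + i y`. -/
def dzbar {E : Type*} [NormedAddCommGroup E] [NormedSpace ℂ E] (G : ℂ → E) (z : ℂ) : E :=
  (1 / 2 : ℂ) • (fderiv ℝ G z 1 + Complex.I • fderiv ℝ G z Complex.I)

/-- The flat Laplacian `∂²/∂x² + ∂²/∂y²`. -/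
def flatLaplacian {E : Type*} [NormedAddCommGroup E] [NormedSpace ℝ E] (G : ℂ → E) (z : ℂ) : E :=
  fderiv ℝ (fun w => fderiv ℝ G w 1) z 1 + fderiv ℝ (fun w => fderiv ℝ G w Complex.I) z Complex.I

/-- The Hermitian product `Z · W̄ = ∑ Z_k conj(W_k)` on `ℂ³`. -/
def herm (Z W : Fin 3 → ℂ) : ℂ := Z ⬝ᵥ star W

/-- The complex projective plane. -/
abbrev CP2 : Type := ℙ ℂ (Fin 3 → ℂ)

/-- `F : ℂ → S⁵ ⊂ ℂ³` is a smooth lift of `f`, horizontal for the Hopf fibration `S⁵ → ℂP²`. -/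
structure IsHorizontalLift (f : ℂ → CP2) (F : ℂ → Fin 3 → ℂ) : Prop where
  smooth : ContDiff ℝ ∞ F
  unit : ∀ z, herm (F z) (F z) = 1
  lift : ∀ z, ∃ h : F z ≠ 0, Projectivization.mk ℂ (F z) h = f z
  horizontal_z : ∀ z, herm (dz F z) (F z) = 0
  horizontal_zbar : ∀ z, herm (dzbar F z) (F z) = 0

/-- `f : ℂ → ℂP²` is a smooth conformal minimal Lagrangian immersion with induced metric
`2 e^u dz dz̄` (for the Fubini-Study metric of holomorphic sectional curvature `4`) and cubic Hopf
differential `φ dz³`. As `ℂ` is simply connected, a smooth immersion `f` is Lagrangian exactly when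
it has a (global) horizontal lift `F`, which is then unique up to a constant phase. Since
`S⁵ → ℂP²` is a Riemannian submersion, the metric, the mean curvature and the Hopf differential
of `f` are computed from `F`. Here `F` spans the fibre direction, the normal space of `f` at `f z`
is identified with the vectors `n` that are Hermitian orthogonal to `F z` and real orthogonal to
`F_x`, `F_y`, and the mean curvature vector is `e^{-u}/4` times the component of `F_xx + F_yy` in
this space. -/
def IsConformalMinimalLagrangian (f : ℂ → CP2) (u : ℂ → ℝ) (φ : ℂ → ℂ) : Prop :=
  ∃ F : ℂ → Fin 3 → ℂ, IsHorizontalLift f F ∧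
    -- conformality, with induced metric `2 e^u dz dz̄`
    (∀ z, herm (dz F z) (dz F z) = (Real.exp (u z) : ℂ)) ∧
    (∀ z, herm (dzbar F z) (dzbar F z) = (Real.exp (u z) : ℂ)) ∧
    (∀ z, herm (dz F z) (dzbar F z) = 0) ∧
    -- minimality: the mean curvature vector vanishes
    (∀ z, ∀ n : Fin 3 → ℂ, herm n (F z) = 0 → (herm n (fderiv ℝ F z 1)).re = 0 →
      (herm n (fderiv ℝ F z Complex.I)).re = 0 → (herm (flatLaplacian F z) n).re = 0) ∧
    -- Hopf differential
    (∀ z, φ z = herm (dz (dz F) z) (dzbar F z))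

/-- The elements of `SU(3)`, acting on `ℂP²` through Mathlib's action of `SL(3, ℂ)`. -/
def IsSU3 (A : Matrix.SpecialLinearGroup (Fin 3) ℂ) : Prop :=
  (A : Matrix (Fin 3) (Fin 3) ℂ) ∈ Matrix.unitaryGroup (Fin 3) ℂ

/-- `f(t + z) = R(t) f(z)` for a one-parameter subgroup `R` of `SU(3)`. -/
def IsTranslationallyEquivariant (f : ℂ → CP2) : Prop :=
  ∃ R : ℝ → Matrix.SpecialLinearGroup (Fin 3) ℂ,
    (∀ t, IsSU3 (R t)) ∧
    Continuous (fun t => (R t : Matrix (Fin 3) (Fin 3) ℂ)) ∧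
    (∀ s t, R (s + t) = R s * R t) ∧
    ∀ (t : ℝ) (z : ℂ), f (t + z) = R t • f z

/-- `λ⁻¹ U₋₁ + U₀`. -/
def frameU (u : ℂ → ℝ) (ψ : ℂ → ℂ) (lam z : ℂ) : Matrix (Fin 3) (Fin 3) ℂ :=
  lam⁻¹ • !![0, 0, Complex.I * Real.exp (u z / 2);
             -Complex.I * ψ z * Real.exp (-u z), 0, 0;
             0, Complex.I * Real.exp (u z / 2), 0] +
  !![dz (fun w => (u w : ℂ)) z / 2, 0, 0;
     0, -dz (fun w => (u w : ℂ)) z / 2, 0;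
     0, 0, 0]

/-- `λ V₁ + V₀`. -/
def frameV (u : ℂ → ℝ) (ψ : ℂ → ℂ) (lam z : ℂ) : Matrix (Fin 3) (Fin 3) ℂ :=
  lam • !![0, -Complex.I * star (ψ z) * Real.exp (-u z), 0;
           0, 0, Complex.I * Real.exp (u z / 2);
           Complex.I * Real.exp (u z / 2), 0, 0] +
  !![-dzbar (fun w => (u w : ℂ)) z / 2, 0, 0;
     0, dzbar (fun w => (u w : ℂ)) z / 2, 0;
     0, 0, 0]

/-- `Φ : ℂ → SU(3)` is the extended frame at `λ` of the data `(u, ψ)`, normalized by `Φ(0) = I`: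
`Φ⁻¹ Φ_z = λ⁻¹ U₋₁ + U₀` and `Φ⁻¹ Φ_z̄ = λ V₁ + V₀`. -/
structure IsExtendedFrame (u : ℂ → ℝ) (ψ : ℂ → ℂ) (lam : ℂ)
    (Φ : ℂ → Matrix (Fin 3) (Fin 3) ℂ) : Prop where
  mem : ∀ z, Φ z ∈ Matrix.specialUnitaryGroup (Fin 3) ℂ
  smooth : ∀ i j, ContDiff ℝ ∞ (fun z => Φ z i j)
  eq_z : ∀ z i j, dz (fun w => Φ w i j) z = (Φ z * frameU u ψ lam z) i j
  eq_zbar : ∀ z i j, dzbar (fun w => Φ w i j) z = (Φ z * frameV u ψ lam z) i j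
  init : Φ 0 = 1

/-- `F = Φ e₃`, the third column of the normalized extended frame `Φ`, where `f = [F]` up to an
isometry `A ∈ SU(3)` of `ℂP²`. -/
def IsCanonicalLift (f : ℂ → CP2) (u : ℂ → ℝ) (ψ : ℂ → ℂ) (lam : ℂ)
    (F : ℂ → Fin 3 → ℂ) : Prop :=
  (∃ Φ, IsExtendedFrame u ψ lam Φ ∧ ∀ z i, F z i = Φ z i 2) ∧
  ∃ A : Matrix.SpecialLinearGroup (Fin 3) ℂ, IsSU3 A ∧
    ∀ z, ∃ h : F z ≠ 0, f z = A • (Projectivization.mk ℂ (F z) h : CP2)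

/-- The generating matrix `D(λ)`, where `a₁ = e^{u(0)}` and `p` is the value of `ψ`. -/
def potentialD (a₁ : ℝ) (p lam : ℂ) : Matrix (Fin 3) (Fin 3) ℂ :=
  !![0, -Complex.I * lam * star p / a₁, Complex.I * lam⁻¹ * Real.sqrt a₁;
     -Complex.I * lam⁻¹ * p / a₁, 0, Complex.I * lam * Real.sqrt a₁;
     Complex.I * lam * Real.sqrt a₁, Complex.I * lam⁻¹ * Real.sqrt a₁, 0]

/-- The elliptic integral of the first kind `∫₀^θ dα / √(1 - k² sin² α)`. -/
def ellipticJ (θ k : ℝ) : ℝ := ∫ α in (0 : ℝ)..θ, 1 / Real.sqrt (1 - k ^ 2 * Real.sin α ^ 2)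

/-- The complete elliptic integral of the first kind. -/
def ellipticK (k : ℝ) : ℝ := ellipticJ (Real.pi / 2) k

/-- The Jacobi amplitude, the inverse function of `θ ↦ ellipticJ θ k` (a bijection of `ℝ` for
`0 ≤ k < 1`). -/
def jacobiAm (x k : ℝ) : ℝ := Function.invFun (fun θ => ellipticJ θ k) x

def jacobiSn (x k : ℝ) : ℝ := Real.sin (jacobiAm x k)

def jacobiCn (x k : ℝ) : ℝ := Real.cos (jacobiAm x k)

def jacobiDn (x k : ℝ) : ℝ := Real.sqrt (1 - k ^ 2 * Real.sin (jacobiAm x k) ^ 2)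

/-- `f` factors through the quotient map `ℂ → ℂ / L`. -/
def DescendsTo (f : ℂ → CP2) (L : AddSubgroup ℂ) : Prop :=
  ∃ g : ℂ ⧸ L → CP2, ∀ z : ℂ, g (QuotientAddGroup.mk z) = f z

end

end MinLag

/-!
The cubic form of a minimal Lagrangian surface is holomorphic, so a real one is constant. By
equivariance `u` depends on `y` only, and the Gauss equation becomes an ordinary differential
equation whose first integral is solved by `e^u = a₁ - (a₁ - a₂) sn²(ry, k)`.

The Maurer–Cartan form of the extended frame `Φ` is therefore invariant under real translations,
hence `Φ(t + z) = Φ(t) Φ(z)` and `Φ(t) = exp (tD)`, where `D` is the value of the form on `∂/∂x` at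
the critical point `0` of `u`. On an eigenvector `l` of `D` with eigenvalue `i d` this gives
`F · l̄ = e^{idx} g(y)`, and the structure equation `F_{z z̄} = -e^u F` turns into Lamé's equation
for `g`. For the three eigenvalues the solutions with the right initial values are multiples of
`sn`, `cn` and `dn`.

A translation by `τ` preserves `f = [F]` exactly when the phases `e^{i d_j τ}` coincide. As
`d₁ + d₂ + d₃ = 0`, some `τ ≠ 0` achieves this if and only if `d₁ / d₂` is rational.
-/

namespace MinLag

section Wirtinger

variable {E F : Type*} [NormedAddCommGroup E] [NormedSpace ℂ E] [NormedAddCommGroup F]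
  [NormedSpace ℂ F] {G H : ℂ → E} {ε δ z : ℂ}

/-- The operator `(∂/∂x + ε ∂/∂y) / 2`. It is `dz` for `ε = -i` and `dzbar` for `ε = i`, so that a
rule of calculus proved for all `ε` holds for both. -/
noncomputable def wirtinger (ε : ℂ) (G : ℂ → E) (z : ℂ) : E :=
  (1 / 2 : ℂ) • (fderiv ℝ G z 1 + ε • fderiv ℝ G z Complex.I)

theorem dz_eq_wirtinger (G : ℂ → E) : dz G = wirtinger (-Complex.I) G := by
  funext z
  rw [dz, wirtinger, neg_smul, sub_eq_add_neg]

theorem dzbar_eq_wirtinger (G : ℂ → E) : dzbar G = wirtinger Complex.I G := rfl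

theorem fderiv_one_eq_dz_add_dzbar (G : ℂ → E) (z : ℂ) :
    fderiv ℝ G z 1 = dz G z + dzbar G z := by
  unfold dz dzbar
  module

theorem fderiv_I_eq_dz_sub_dzbar (G : ℂ → E) (z : ℂ) :
    fderiv ℝ G z Complex.I = Complex.I • (dz G z - dzbar G z) := by
  have h : Complex.I • (dz G z - dzbar G z) =
      -(Complex.I * Complex.I) • fderiv ℝ G z Complex.I := by
    unfold dz dzbar
    module
  rw [h, Complex.I_mul_I, neg_neg, one_smul]

theorem fderiv_eq_zero_of_dz_eq_zero_of_dzbar_eq_zero (h : dz G z = 0) (h' : dzbar G z = 0) :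
    fderiv ℝ G z = 0 := by
  refine ContinuousLinearMap.coe_injective (Complex.basisOneI.ext fun i => ?_)
  fin_cases i <;>
    simp [fderiv_one_eq_dz_add_dzbar, fderiv_I_eq_dz_sub_dzbar, h, h']

theorem eq_of_dz_eq_zero_of_dzbar_eq_zero (hG : Differentiable ℝ G) (h : ∀ z, dz G z = 0)
    (h' : ∀ z, dzbar G z = 0) (z w : ℂ) : G z = G w :=
  is_const_of_fderiv_eq_zero hG
    (fun z => fderiv_eq_zero_of_dz_eq_zero_of_dzbar_eq_zero (h z) (h' z)) z w

theorem contDiff_wirtinger (hG : ContDiff ℝ ∞ G) : ContDiff ℝ ∞ (wirtinger ε G) := by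
  have hv : ∀ v, ContDiff ℝ ∞ fun z => fderiv ℝ G z v := fun v =>
    (contDiff_infty_iff_fderiv.1 hG).2.clm_apply contDiff_const
  exact ((hv 1).add ((hv Complex.I).const_smul ε)).const_smul _

theorem wirtinger_const (c : E) : wirtinger ε (fun _ => c) z = 0 := by
  simp [wirtinger]

theorem wirtinger_add (hG : DifferentiableAt ℝ G z) (hH : DifferentiableAt ℝ H z) :
    wirtinger ε (fun w => G w + H w) z = wirtinger ε G z + wirtinger ε H z := by
  simp only [wirtinger, fderiv_fun_add hG hH, _root_.add_apply]
  module

theorem wirtinger_sum {ι : Type*} {s : Finset ι} {G : ι → ℂ → E}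
    (hG : ∀ i ∈ s, DifferentiableAt ℝ (G i) z) :
    wirtinger ε (fun w => ∑ i ∈ s, G i w) z = ∑ i ∈ s, wirtinger ε (G i) z := by
  simp only [wirtinger, fderiv_fun_sum hG, _root_.sum_apply, Finset.smul_sum,
    ← Finset.sum_add_distrib]

theorem wirtinger_smul {g : ℂ → ℂ} (hg : DifferentiableAt ℝ g z) (hG : DifferentiableAt ℝ G z) :
    wirtinger ε (fun w => g w • G w) z = wirtinger ε g z • G z + g z • wirtinger ε G z := by
  simp only [wirtinger, fderiv_fun_smul hg hG, _root_.add_apply, _root_.smul_apply,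
    ContinuousLinearMap.smulRight_apply, smul_eq_mul]
  module

theorem wirtinger_mul {g h : ℂ → ℂ} (hg : DifferentiableAt ℝ g z) (hh : DifferentiableAt ℝ h z) :
    wirtinger ε (fun w => g w * h w) z = wirtinger ε g z * h z + g z * wirtinger ε h z :=
  wirtinger_smul hg hh

theorem wirtinger_prod {ι : Type*} [DecidableEq ι] {s : Finset ι} {g : ι → ℂ → ℂ}
    (hg : ∀ i ∈ s, DifferentiableAt ℝ (g i) z) :
    wirtinger ε (fun w => ∏ i ∈ s, g i w) z =
      ∑ i ∈ s, (∏ j ∈ s.erase i, g j z) * wirtinger ε (g i) z := by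
  have h := (HasFDerivAt.finsetProd fun i hi => (hg i hi).hasFDerivAt).fderiv
  simp only [wirtinger, h, _root_.sum_apply, _root_.smul_apply, smul_eq_mul,
    Finset.mul_sum, ← Finset.sum_add_distrib]
  exact Finset.sum_congr rfl fun i _ => by ring

theorem wirtinger_clm_comp (L : E →L[ℂ] F) (hG : DifferentiableAt ℝ G z) :
    wirtinger ε (fun w => L (G w)) z = L (wirtinger ε G z) := by
  have h := ((L.restrictScalars ℝ).hasFDerivAt.comp z hG.hasFDerivAt).fderiv
  have h' : fderiv ℝ (fun w => L (G w)) z = (L.restrictScalars ℝ).comp (fderiv ℝ G z) := h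
  simp [wirtinger, h']

theorem wirtinger_const_smul (c : ℂ) (hG : DifferentiableAt ℝ G z) :
    wirtinger ε (fun w => c • G w) z = c • wirtinger ε G z :=
  wirtinger_clm_comp (c • ContinuousLinearMap.id ℂ E) hG

theorem wirtinger_apply {ι : Type*} [Fintype ι] {G : ℂ → ι → ℂ} (hG : DifferentiableAt ℝ G z)
    (i : ι) : wirtinger ε G z i = wirtinger ε (fun w => G w i) z :=
  (wirtinger_clm_comp (ContinuousLinearMap.proj (R := ℂ) (φ := fun _ : ι => ℂ) i) hG).symm

theorem wirtinger_star {g : ℂ → ℂ} (hg : DifferentiableAt ℝ g z) :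
    wirtinger ε (fun w => star (g w)) z = star (wirtinger (star ε) g z) := by
  have h : fderiv ℝ (fun w => star (g w)) z = Complex.conjCLE.toContinuousLinearMap.comp
      (fderiv ℝ g z) :=
    (Complex.conjCLE.toContinuousLinearMap.hasFDerivAt.comp z hg.hasFDerivAt).fderiv
  simp only [wirtinger, h]
  simp

theorem wirtinger_ofReal_comp {g : ℝ → ℝ} {g' : ℝ} {u : ℂ → ℝ} (hg : HasDerivAt g g' (u z))
    (hu : DifferentiableAt ℝ u z) :
    wirtinger ε (fun w => (g (u w) : ℂ)) z = g' * wirtinger ε (fun w => (u w : ℂ)) z := by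
  have hofReal : ∀ {v : ℂ → ℝ} {v' : ℂ →L[ℝ] ℝ}, HasFDerivAt v v' z →
      fderiv ℝ (fun w => (v w : ℂ)) z = Complex.ofRealCLM.comp v' := fun hv =>
    (Complex.ofRealCLM.hasFDerivAt.comp z hv).fderiv
  have hgu := hg.comp_hasFDerivAt z hu.hasFDerivAt
  simp only [wirtinger, hofReal hu.hasFDerivAt, hofReal (v := fun w => g (u w)) hgu,
    ContinuousLinearMap.comp_apply, _root_.smul_apply, Complex.ofRealCLM_apply, smul_eq_mul,
    Complex.ofReal_mul]
  ring

theorem wirtinger_comp_add_left (G : ℂ → E) (t z : ℂ) :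
    wirtinger ε (fun w => G (t + w)) z = wirtinger ε G (t + z) := by
  simp only [wirtinger, fderiv_comp_add_left]

theorem hasFDerivAt_fderiv_apply (hG : ContDiff ℝ ∞ G) (z v : ℂ) :
    HasFDerivAt (fun w => fderiv ℝ G w v) ((fderiv ℝ (fderiv ℝ G) z).flip v) z := by
  have hG' := (contDiff_infty_iff_fderiv.1 hG).2.differentiable (by simp) z
  simpa using hG'.hasFDerivAt.clm_apply (hasFDerivAt_const v z)

theorem wirtinger_wirtinger (hG : ContDiff ℝ ∞ G) :
    wirtinger δ (wirtinger ε G) z = (1 / 4 : ℂ) •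
      (fderiv ℝ (fderiv ℝ G) z 1 1 + (ε + δ) • fderiv ℝ (fderiv ℝ G) z 1 Complex.I +
        (δ * ε) • fderiv ℝ (fderiv ℝ G) z Complex.I Complex.I) := by
  have hsymm : fderiv ℝ (fderiv ℝ G) z Complex.I 1 = fderiv ℝ (fderiv ℝ G) z 1 Complex.I :=
    ((contDiff_infty.1 hG 2).contDiffAt.isSymmSndFDerivAt (by simp)).eq Complex.I 1
  have hv := hasFDerivAt_fderiv_apply hG z
  have h : fderiv ℝ (wirtinger ε G) z = (1 / 2 : ℂ) • ((fderiv ℝ (fderiv ℝ G) z).flip 1 +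
      ε • (fderiv ℝ (fderiv ℝ G) z).flip Complex.I) :=
    (((hv 1).add ((hv Complex.I).const_smul ε)).const_smul (1 / 2 : ℂ)).fderiv
  rw [wirtinger, h]
  simp only [_root_.smul_apply, _root_.add_apply, ContinuousLinearMap.flip_apply, hsymm]
  module

theorem dzbar_dz_eq_dz_dzbar (hG : ContDiff ℝ ∞ G) (z : ℂ) : dzbar (dz G) z = dz (dzbar G) z := by
  rw [dz_eq_wirtinger, dz_eq_wirtinger, dzbar_eq_wirtinger, dzbar_eq_wirtinger,
    wirtinger_wirtinger hG, wirtinger_wirtinger hG]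
  module

theorem flatLaplacian_eq_four_smul_dzbar_dz (hG : ContDiff ℝ ∞ G) (z : ℂ) :
    flatLaplacian G z = (4 : ℂ) • dzbar (dz G) z := by
  rw [dz_eq_wirtinger, dzbar_eq_wirtinger, wirtinger_wirtinger hG, flatLaplacian,
    (hasFDerivAt_fderiv_apply hG z 1).fderiv, (hasFDerivAt_fderiv_apply hG z Complex.I).fderiv,
    mul_neg, Complex.I_mul_I, ContinuousLinearMap.flip_apply, ContinuousLinearMap.flip_apply]
  module

end Wirtinger

section DzDzbar

variable {E : Type*} [NormedAddCommGroup E] [NormedSpace ℂ E] {G : ℂ → E} {z : ℂ}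

theorem contDiff_dz (hG : ContDiff ℝ ∞ G) : ContDiff ℝ ∞ (dz G) := by
  rw [dz_eq_wirtinger]
  exact contDiff_wirtinger hG

theorem contDiff_dzbar (hG : ContDiff ℝ ∞ G) : ContDiff ℝ ∞ (dzbar G) :=
  contDiff_wirtinger hG

theorem dz_const (c : E) : dz (fun _ => c) z = 0 := by
  rw [dz_eq_wirtinger, wirtinger_const]

theorem dzbar_const (c : E) : dzbar (fun _ => c) z = 0 :=
  wirtinger_const c

theorem dzbar_add {H : ℂ → E} (hG : DifferentiableAt ℝ G z) (hH : DifferentiableAt ℝ H z) :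
    dzbar (fun w => G w + H w) z = dzbar G z + dzbar H z :=
  wirtinger_add hG hH

theorem dz_smul {g : ℂ → ℂ} (hg : DifferentiableAt ℝ g z) (hG : DifferentiableAt ℝ G z) :
    dz (fun w => g w • G w) z = dz g z • G z + g z • dz G z := by
  simp only [dz_eq_wirtinger, wirtinger_smul hg hG]

theorem dzbar_smul {g : ℂ → ℂ} (hg : DifferentiableAt ℝ g z) (hG : DifferentiableAt ℝ G z) :
    dzbar (fun w => g w • G w) z = dzbar g z • G z + g z • dzbar G z :=
  wirtinger_smul hg hG

theorem dzbar_mul {g h : ℂ → ℂ} (hg : DifferentiableAt ℝ g z) (hh : DifferentiableAt ℝ h z) :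
    dzbar (fun w => g w * h w) z = dzbar g z * h z + g z * dzbar h z :=
  wirtinger_mul hg hh

theorem dz_ofReal_comp {g : ℝ → ℝ} {g' : ℝ} {u : ℂ → ℝ} (hg : HasDerivAt g g' (u z))
    (hu : DifferentiableAt ℝ u z) :
    dz (fun w => (g (u w) : ℂ)) z = g' * dz (fun w => (u w : ℂ)) z := by
  simp only [dz_eq_wirtinger, wirtinger_ofReal_comp hg hu]

theorem dzbar_ofReal_comp {g : ℝ → ℝ} {g' : ℝ} {u : ℂ → ℝ} (hg : HasDerivAt g g' (u z))
    (hu : DifferentiableAt ℝ u z) :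
    dzbar (fun w => (g (u w) : ℂ)) z = g' * dzbar (fun w => (u w : ℂ)) z :=
  wirtinger_ofReal_comp hg hu

theorem star_dz {g : ℂ → ℂ} (hg : DifferentiableAt ℝ g z) :
    star (dz g z) = dzbar (fun w => star (g w)) z := by
  rw [dz_eq_wirtinger, dzbar_eq_wirtinger, wirtinger_star hg]
  simp

end DzDzbar

section Herm

theorem herm_add_left (X Y W : Fin 3 → ℂ) : herm (X + Y) W = herm X W + herm Y W := by
  simp only [herm, add_dotProduct]

theorem herm_sub_left (X Y W : Fin 3 → ℂ) : herm (X - Y) W = herm X W - herm Y W := by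
  simp only [herm, sub_dotProduct]

theorem herm_smul_left (c : ℂ) (X W : Fin 3 → ℂ) : herm (c • X) W = c * herm X W := by
  simp only [herm, smul_dotProduct, smul_eq_mul]

theorem star_herm (X Y : Fin 3 → ℂ) : star (herm X Y) = herm Y X :=
  (Matrix.dotProduct_star Y X).symm

theorem herm_add_right (X Y W : Fin 3 → ℂ) : herm W (X + Y) = herm W X + herm W Y := by
  simp only [herm, star_add, dotProduct_add]

theorem herm_sub_right (X Y W : Fin 3 → ℂ) : herm W (X - Y) = herm W X - herm W Y := by
  simp only [herm, star_sub, dotProduct_sub]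

theorem herm_smul_right (c : ℂ) (X W : Fin 3 → ℂ) : herm W (c • X) = star c * herm W X := by
  simp only [herm, star_smul, dotProduct_smul, smul_eq_mul]

theorem herm_eq_zero_comm {X Y : Fin 3 → ℂ} : herm X Y = 0 ↔ herm Y X = 0 := by
  rw [← star_herm, star_eq_zero]

open scoped ComplexOrder in
theorem herm_self_eq_zero {X : Fin 3 → ℂ} : herm X X = 0 ↔ X = 0 :=
  dotProduct_self_star_eq_zero

theorem herm_mulVec_left (B : Matrix (Fin 3) (Fin 3) ℂ) (X Y : Fin 3 → ℂ) :
    herm (B *ᵥ X) Y = herm X (Bᴴ *ᵥ Y) := by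
  rw [herm, herm, Matrix.star_mulVec, Matrix.conjTranspose_conjTranspose, dotProduct_comm,
    Matrix.dotProduct_mulVec, dotProduct_comm]

theorem herm_mulVec_mulVec {B : Matrix (Fin 3) (Fin 3) ℂ} (hB : B ∈ Matrix.unitaryGroup (Fin 3) ℂ)
    (X Y : Fin 3 → ℂ) : herm (B *ᵥ X) (B *ᵥ Y) = herm X Y := by
  rw [herm_mulVec_left, Matrix.mulVec_mulVec, ← Matrix.star_eq_conjTranspose,
    Matrix.mem_unitaryGroup_iff'.1 hB, Matrix.one_mulVec]

section Calculus

variable {G H : ℂ → Fin 3 → ℂ} {ε z : ℂ}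

theorem contDiff_star {g : ℂ → ℂ} (hg : ContDiff ℝ ∞ g) : ContDiff ℝ ∞ fun w => star (g w) :=
  Complex.conjCLE.contDiff.comp hg

theorem contDiff_herm (hG : ContDiff ℝ ∞ G) (hH : ContDiff ℝ ∞ H) :
    ContDiff ℝ ∞ fun w => herm (G w) (H w) := by
  simp only [herm, dotProduct]
  exact ContDiff.sum fun i _ => (contDiff_pi.1 hG i).mul (contDiff_star (contDiff_pi.1 hH i))

theorem wirtinger_herm (hG : DifferentiableAt ℝ G z) (hH : DifferentiableAt ℝ H z) :
    wirtinger ε (fun w => herm (G w) (H w)) z =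
      herm (wirtinger ε G z) (H z) + herm (G z) (wirtinger (star ε) H z) := by
  have hG' := differentiableAt_pi.1 hG
  have hH' := differentiableAt_pi.1 hH
  have hH'' : ∀ i, DifferentiableAt ℝ (fun w => star (H w i)) z := fun i =>
    Complex.conjCLE.differentiableAt.comp z (hH' i)
  simp only [herm, dotProduct, Pi.star_apply]
  rw [wirtinger_sum fun i _ => (hG' i).fun_mul (hH'' i), ← Finset.sum_add_distrib]
  exact Finset.sum_congr rfl fun i _ => by
    rw [wirtinger_mul (hG' i) (hH'' i), wirtinger_star (hH' i), wirtinger_apply hG,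
      wirtinger_apply hH]

theorem dz_herm (hG : DifferentiableAt ℝ G z) (hH : DifferentiableAt ℝ H z) :
    dz (fun w => herm (G w) (H w)) z = herm (dz G z) (H z) + herm (G z) (dzbar H z) := by
  simp [dz_eq_wirtinger, dzbar_eq_wirtinger, wirtinger_herm hG hH]

theorem dzbar_herm (hG : DifferentiableAt ℝ G z) (hH : DifferentiableAt ℝ H z) :
    dzbar (fun w => herm (G w) (H w)) z = herm (dzbar G z) (H z) + herm (G z) (dz H z) := by
  simp [dz_eq_wirtinger, dzbar_eq_wirtinger, wirtinger_herm hG hH]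

end Calculus

/-- The family `e` is orthogonal for the Hermitian product, with squared lengths `m`. -/
def IsHermOrthogonal (e : Fin 3 → Fin 3 → ℂ) (m : Fin 3 → ℂ) : Prop :=
  ∀ i j, herm (e i) (e j) = if i = j then m i else 0

theorem isHermOrthogonal_vec {a b c : Fin 3 → ℂ} (hab : herm a b = 0) (hac : herm a c = 0)
    (hbc : herm b c = 0) : IsHermOrthogonal ![a, b, c] ![herm a a, herm b b, herm c c] := by
  intro i j
  fin_cases i <;> fin_cases j <;>
    simp [hab, hac, hbc, herm_eq_zero_comm.1 hab, herm_eq_zero_comm.1 hac, herm_eq_zero_comm.1 hbc]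

namespace IsHermOrthogonal

variable {e : Fin 3 → Fin 3 → ℂ} {m : Fin 3 → ℂ}

theorem smul (he : IsHermOrthogonal e m) (c : Fin 3 → ℂ) :
    IsHermOrthogonal (fun i => c i • e i) fun i => c i * star (c i) * m i := by
  intro i j
  rw [herm_smul_left, herm_smul_right, he]
  rcases eq_or_ne i j with rfl | hij
  · simp [mul_assoc]
  · simp [hij]

theorem mul_conjTranspose (he : IsHermOrthogonal e m) :
    Matrix.of e * (Matrix.of e)ᴴ = Matrix.diagonal m := by
  ext i j
  rw [Matrix.diagonal_apply, ← he i j]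
  rfl

theorem transpose_mem_unitaryGroup (he : IsHermOrthogonal e 1) :
    (Matrix.of e)ᵀ ∈ Matrix.unitaryGroup (Fin 3) ℂ := by
  have h := congrArg Matrix.transpose he.mul_conjTranspose
  rw [Matrix.transpose_mul, Matrix.diagonal_transpose] at h
  exact Matrix.mem_unitaryGroup_iff'.2 h

theorem ext (he : IsHermOrthogonal e m) (hm : ∀ i, m i ≠ 0) {X Y : Fin 3 → ℂ}
    (h : ∀ i, herm X (e i) = herm Y (e i)) : X = Y := by
  have hdet : (Matrix.of e).det * (Matrix.of e)ᴴ.det ≠ 0 := by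
    rw [← Matrix.det_mul, he.mul_conjTranspose, Matrix.det_diagonal]
    exact Finset.prod_ne_zero_iff.2 fun i _ => hm i
  refine star_injective (Matrix.mulVec_injective_of_isUnit ((Matrix.isUnit_iff_isUnit_det _).2
    (isUnit_iff_ne_zero.2 (left_ne_zero_of_mul hdet))) (funext fun i => ?_))
  have hi := congrArg star (h i)
  rwa [star_herm, star_herm] at hi

theorem herm_sum_smul (he : IsHermOrthogonal e m) (c : Fin 3 → ℂ) (j : Fin 3) :
    herm (∑ i, c i • e i) (e j) = c j * m j := by
  have hsum : herm (∑ i, c i • e i) (e j) = ∑ i, c i * herm (e i) (e j) := by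
    simp only [herm, sum_dotProduct, smul_dotProduct, smul_eq_mul]
  simp [hsum, he _ _]

theorem sum_herm_smul (he : IsHermOrthogonal e 1) (X : Fin 3 → ℂ) :
    ∑ i, herm X (e i) • e i = X :=
  he.ext (fun _ => one_ne_zero) fun j => by rw [he.herm_sum_smul, Pi.one_apply, mul_one]

end IsHermOrthogonal

end Herm

section Matrix

variable {n : Type*} [Fintype n] {ε z : ℂ} {Φ : ℂ → Matrix n n ℂ}

theorem wirtinger_const_mul_matrix_apply (B : Matrix n n ℂ)
    (hΦ : ∀ i j, DifferentiableAt ℝ (fun w => Φ w i j) z) (i j : n) :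
    wirtinger ε (fun w => (B * Φ w) i j) z = ∑ k, B i k * wirtinger ε (fun w => Φ w k j) z := by
  simp only [Matrix.mul_apply]
  rw [wirtinger_sum fun k _ => (hΦ k j).const_mul _]
  exact Finset.sum_congr rfl fun k _ => wirtinger_const_smul (B i k) (hΦ k j)

variable [DecidableEq n]

theorem det_updateCol_eq_sum (A : Matrix n n ℂ) (j : n) (v : n → ℂ) :
    (A.updateCol j v).det =
      ∑ σ : Equiv.Perm n,
        Equiv.Perm.sign σ • ((∏ i ∈ Finset.univ.erase j, A (σ i) i) * v (σ j)) := by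
  rw [Matrix.det_apply]
  refine Finset.sum_congr rfl fun σ _ => ?_
  rw [← Finset.prod_erase_mul _ _ (Finset.mem_univ j), Matrix.updateCol_self]
  congr 2
  exact Finset.prod_congr rfl fun i hi => Matrix.updateCol_ne (Finset.ne_of_mem_erase hi)

theorem wirtinger_det (hΦ : ∀ i j, DifferentiableAt ℝ (fun w => Φ w i j) z) :
    wirtinger ε (fun w => (Φ w).det) z =
      ∑ j, ((Φ z).updateCol j fun i => wirtinger ε (fun w => Φ w i j) z).det := by
  have hprod : ∀ σ : Equiv.Perm n, DifferentiableAt ℝ (fun w => ∏ i, Φ w (σ i) i) z := fun σ =>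
    (HasFDerivAt.finsetProd fun i _ => (hΦ (σ i) i).hasFDerivAt).differentiableAt
  simp only [det_updateCol_eq_sum]
  simp only [Matrix.det_apply]
  rw [Finset.sum_comm, wirtinger_sum fun σ _ => (hprod σ).fun_const_smul (Equiv.Perm.sign σ)]
  refine Finset.sum_congr rfl fun σ _ => ?_
  simp only [← Finset.smul_sum, Units.smul_def, ← Int.cast_smul_eq_zsmul ℂ]
  rw [wirtinger_const_smul _ (hprod σ), wirtinger_prod fun i _ => hΦ (σ i) i]

theorem wirtinger_det_of_eq_mul (hΦ : ∀ i j, DifferentiableAt ℝ (fun w => Φ w i j) z)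
    {A : Matrix n n ℂ} (h : ∀ i j, wirtinger ε (fun w => Φ w i j) z = (Φ z * A) i j) :
    wirtinger ε (fun w => (Φ w).det) z = A.trace * (Φ z).det := by
  rw [wirtinger_det hΦ, Matrix.trace, Finset.sum_mul]
  refine Finset.sum_congr rfl fun j _ => ?_
  simp only [h, Matrix.mul_apply, Matrix.diag_apply]
  rw [← smul_eq_mul, ← Matrix.det_updateCol_sum (Φ z) j fun k => A k j]
  simp only [smul_eq_mul, mul_comm]

end Matrix

/-- A horizontal map `F : ℂ → S⁵` which is conformal with metric `2 e^u dz dz̄`, minimal, and has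
cubic differential `φ dz³`: the conditions that `IsConformalMinimalLagrangian` imposes on a
horizontal lift, without reference to the map into `ℂP²`. -/
structure IsMinimalLegendrian (F : ℂ → Fin 3 → ℂ) (u : ℂ → ℝ) (φ : ℂ → ℂ) : Prop where
  smooth : ContDiff ℝ ∞ F
  unit : ∀ z, herm (F z) (F z) = 1
  horizontal_z : ∀ z, herm (dz F z) (F z) = 0
  horizontal_zbar : ∀ z, herm (dzbar F z) (F z) = 0
  metric_z : ∀ z, herm (dz F z) (dz F z) = (Real.exp (u z) : ℂ)
  metric_zbar : ∀ z, herm (dzbar F z) (dzbar F z) = (Real.exp (u z) : ℂ)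
  conformal : ∀ z, herm (dz F z) (dzbar F z) = 0
  minimal : ∀ z, ∀ n : Fin 3 → ℂ, herm n (F z) = 0 → (herm n (fderiv ℝ F z 1)).re = 0 →
    (herm n (fderiv ℝ F z Complex.I)).re = 0 → (herm (flatLaplacian F z) n).re = 0
  hopf : ∀ z, φ z = herm (dz (dz F) z) (dzbar F z)

theorem IsConformalMinimalLagrangian.exists_isMinimalLegendrian {f : ℂ → CP2} {u : ℂ → ℝ}
    {φ : ℂ → ℂ} (hf : IsConformalMinimalLagrangian f u φ) :
    ∃ F, IsHorizontalLift f F ∧ IsMinimalLegendrian F u φ := by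
  obtain ⟨F, hF, hz, hzbar, hconf, hmin, hhopf⟩ := hf
  exact ⟨F, hF, hF.smooth, hF.unit, hF.horizontal_z, hF.horizontal_zbar, hz, hzbar, hconf, hmin,
    hhopf⟩

theorem exp_neg_mul_exp (x : ℝ) : (Real.exp (-x) : ℂ) * Real.exp x = 1 := by
  rw [← Complex.ofReal_mul, ← Real.exp_add, neg_add_cancel, Real.exp_zero, Complex.ofReal_one]

namespace IsMinimalLegendrian

variable {F : ℂ → Fin 3 → ℂ} {u : ℂ → ℝ} {φ : ℂ → ℂ} (h : IsMinimalLegendrian F u φ)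
include h

theorem differentiable : Differentiable ℝ F := h.smooth.differentiable (by simp)

theorem differentiable_dz : Differentiable ℝ (dz F) :=
  (contDiff_dz h.smooth).differentiable (by simp)

theorem differentiable_dzbar : Differentiable ℝ (dzbar F) :=
  (contDiff_dzbar h.smooth).differentiable (by simp)

theorem contDiff_u : ContDiff ℝ ∞ u := by
  have hre : ∀ z, (herm (dz F z) (dz F z)).re = Real.exp (u z) := fun z => by
    rw [h.metric_z, Complex.ofReal_re]
  have hsmooth : ContDiff ℝ ∞ fun z => Real.exp (u z) := by
    simp only [← hre]
    exact Complex.reCLM.contDiff.comp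
      (contDiff_herm (contDiff_dz h.smooth) (contDiff_dz h.smooth))
  simpa only [Real.log_exp] using hsmooth.log fun z => (Real.exp_pos _).ne'

theorem differentiable_u : Differentiable ℝ u := h.contDiff_u.differentiable (by simp)

theorem contDiff_ofReal_u : ContDiff ℝ ∞ fun w => (u w : ℂ) :=
  Complex.ofRealCLM.contDiff.comp h.contDiff_u

theorem contDiff_cubicForm : ContDiff ℝ ∞ φ := by
  rw [funext h.hopf]
  exact contDiff_herm (contDiff_dz (contDiff_dz h.smooth)) (contDiff_dzbar h.smooth)

theorem differentiable_cubicForm : Differentiable ℝ φ :=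
  h.contDiff_cubicForm.differentiable (by simp)

theorem differentiable_exp_comp {g : ℝ → ℝ} (hg : Differentiable ℝ g) :
    Differentiable ℝ fun w => (Real.exp (g (u w)) : ℂ) := fun z =>
  (Complex.ofRealCLM.hasFDerivAt.comp z
    (((hg _).comp z (h.differentiable_u z)).exp).hasFDerivAt).differentiableAt

theorem isHermOrthogonal (z : ℂ) :
    IsHermOrthogonal ![dz F z, dzbar F z, F z] ![(Real.exp (u z) : ℂ), Real.exp (u z), 1] := by
  have horth := isHermOrthogonal_vec (h.conformal z) (h.horizontal_z z) (h.horizontal_zbar z)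
  rwa [h.metric_z, h.metric_zbar, h.unit] at horth

theorem ext {z : ℂ} {X Y : Fin 3 → ℂ} (hdz : herm X (dz F z) = herm Y (dz F z))
    (hdzbar : herm X (dzbar F z) = herm Y (dzbar F z)) (hF : herm X (F z) = herm Y (F z)) :
    X = Y := by
  refine (h.isHermOrthogonal z).ext (fun i => ?_) fun i => ?_
  · fin_cases i <;> simp
  · fin_cases i
    exacts [hdz, hdzbar, hF]

theorem herm_dzbar_dz_self (z : ℂ) : herm (dzbar (dz F) z) (F z) = -(Real.exp (u z) : ℂ) := by
  have hd := dzbar_herm (h.differentiable_dz z) (h.differentiable z)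
  simp only [h.horizontal_z, dzbar_const, h.metric_z] at hd
  linear_combination -hd

theorem herm_dzbar_dz_dzbar (z : ℂ) : herm (dzbar (dz F) z) (dzbar F z) =
    -star (herm (dzbar (dz F) z) (dz F z)) := by
  have hd := dzbar_herm (h.differentiable_dz z) (h.differentiable_dzbar z)
  simp only [h.conformal, dzbar_const, ← dzbar_dz_eq_dz_dzbar h.smooth] at hd
  rw [star_herm]
  linear_combination -hd

-- The normal space of the surface is spanned over `ℝ` by `i F_x` and `i F_y`.
theorem herm_dzbar_dz_dz_eq_zero (z : ℂ) : herm (dzbar (dz F) z) (dz F z) = 0 := by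
  have hnormal : ∀ c : ℂ, (herm (flatLaplacian F z) (c • dz F z - star c • dzbar F z)).re = 0 := by
    intro c
    have hconf := h.conformal z
    have hconf' := herm_eq_zero_comm.1 hconf
    refine h.minimal z _ ?_ ?_ ?_
    · simp [herm_sub_left, herm_smul_left, h.horizontal_z, h.horizontal_zbar]
    · simp [fderiv_one_eq_dz_add_dzbar, herm_sub_left, herm_add_right, herm_smul_left, h.metric_z,
        h.metric_zbar, hconf, hconf']
    · simp [fderiv_I_eq_dz_sub_dzbar, herm_sub_left, herm_sub_right, herm_smul_left,
        herm_smul_right, h.metric_z, h.metric_zbar, hconf, hconf']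
  set p := herm (dzbar (dz F) z) (dz F z) with hp
  have hre := hnormal p
  rw [flatLaplacian_eq_four_smul_dzbar_dz h.smooth, herm_smul_left, herm_sub_right,
    herm_smul_right, herm_smul_right, h.herm_dzbar_dz_dzbar, ← hp, star_star,
    show 4 * (star p * p - p * -star p) = 8 * (p * star p) by ring, Complex.star_def,
    Complex.mul_conj, ← Complex.ofReal_ofNat, Complex.re_ofReal_mul, Complex.ofReal_re] at hre
  exact Complex.normSq_eq_zero.1 ((mul_eq_zero_iff_left (by norm_num)).1 hre)

theorem dzbar_dz (z : ℂ) : dzbar (dz F) z = (-(Real.exp (u z)) : ℂ) • F z := by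
  refine h.ext (z := z) ?_ ?_ ?_
  · rw [h.herm_dzbar_dz_dz_eq_zero, herm_smul_left, herm_eq_zero_comm.1 (h.horizontal_z z),
      mul_zero]
  · rw [h.herm_dzbar_dz_dzbar, h.herm_dzbar_dz_dz_eq_zero, star_zero, neg_zero, herm_smul_left,
      herm_eq_zero_comm.1 (h.horizontal_zbar z), mul_zero]
  · rw [h.herm_dzbar_dz_self, herm_smul_left, h.unit, mul_one]

theorem dz_dzbar (z : ℂ) : dz (dzbar F) z = (-(Real.exp (u z)) : ℂ) • F z := by
  rw [← dzbar_dz_eq_dz_dzbar h.smooth, h.dzbar_dz]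

theorem dz_dz (z : ℂ) : dz (dz F) z = dz (fun w => (u w : ℂ)) z • dz F z +
    (φ z * Real.exp (-u z)) • dzbar F z := by
  refine h.ext (z := z) ?_ ?_ ?_
  · have hd := dz_herm (h.differentiable_dz z) (h.differentiable_dz z)
    simp only [h.metric_z] at hd
    rw [dz_ofReal_comp (Real.hasDerivAt_exp _) (h.differentiable_u z), ← star_herm (dzbar (dz F) z),
      h.herm_dzbar_dz_dz_eq_zero, star_zero, add_zero] at hd
    rw [← hd, herm_add_left, herm_smul_left, herm_smul_left, h.metric_z,
      herm_eq_zero_comm.1 (h.conformal z)]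
    ring
  · rw [← h.hopf, herm_add_left, herm_smul_left, herm_smul_left, h.conformal, h.metric_zbar]
    linear_combination -φ z * exp_neg_mul_exp (u z)
  · have hd := dz_herm (h.differentiable_dz z) (h.differentiable z)
    simp only [h.horizontal_z, dz_const, h.conformal, add_zero] at hd
    rw [← hd, herm_add_left, herm_smul_left, herm_smul_left, h.horizontal_z, h.horizontal_zbar]
    ring

theorem dzbar_dzbar (z : ℂ) : dzbar (dzbar F) z = dzbar (fun w => (u w : ℂ)) z • dzbar F z +
    (-star (φ z) * Real.exp (-u z)) • dz F z := by
  refine h.ext (z := z) ?_ ?_ ?_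
  · have hd := dz_herm (h.differentiable_dz z) (h.differentiable_dzbar z)
    simp only [h.conformal, dz_const, ← h.hopf] at hd
    have hhopf : herm (dzbar (dzbar F) z) (dz F z) = -star (φ z) := by
      rw [← star_herm, ← star_neg]
      congr 1
      linear_combination -hd
    rw [hhopf, herm_add_left, herm_smul_left, herm_smul_left, h.metric_z,
      herm_eq_zero_comm.1 (h.conformal z)]
    linear_combination star (φ z) * exp_neg_mul_exp (u z)
  · have hd := dzbar_herm (h.differentiable_dzbar z) (h.differentiable_dzbar z)
    simp only [h.metric_zbar] at hd
    rw [dzbar_ofReal_comp (Real.hasDerivAt_exp _) (h.differentiable_u z), h.dz_dzbar,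
      herm_smul_right, h.horizontal_zbar z, mul_zero, add_zero] at hd
    rw [← hd, herm_add_left, herm_smul_left, herm_smul_left, h.metric_zbar, h.conformal]
    ring
  · have hd := dzbar_herm (h.differentiable_dzbar z) (h.differentiable z)
    simp only [h.horizontal_zbar, dzbar_const, herm_eq_zero_comm.1 (h.conformal z), add_zero] at hd
    rw [← hd, herm_add_left, herm_smul_left, herm_smul_left, h.horizontal_z, h.horizontal_zbar]
    ring

/-- The compatibility condition `∂_z̄ F_zz = ∂_z F_zz̄`, expanded in the frame `F_z, F_z̄, F`. -/
theorem compatibility (z : ℂ) :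
    (dzbar (dz (fun w => (u w : ℂ))) z - φ z * star (φ z) * Real.exp (-u z) ^ 2) • dz F z +
      (dzbar φ z * Real.exp (-u z)) • dzbar F z = (-Real.exp (u z) : ℂ) • dz F z := by
  have hdu := (contDiff_dz h.contDiff_ofReal_u).differentiable (by simp) z
  have hφ := h.differentiable_cubicForm z
  have hexp : DifferentiableAt ℝ (fun w => (-Real.exp (u w) : ℂ)) z :=
    (h.differentiable_exp_comp differentiable_id z).fun_neg
  have hexpneg := h.differentiable_exp_comp differentiable_neg z
  have hdexp : dz (fun w => (-Real.exp (u w) : ℂ)) z =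
      -(Real.exp (u z) : ℂ) * dz (fun w => (u w : ℂ)) z := by
    simpa using dz_ofReal_comp (Real.hasDerivAt_exp (u z)).fun_neg (h.differentiable_u z)
  have hdexpneg : dzbar (fun w => (Real.exp (-u w) : ℂ)) z =
      -(Real.exp (-u z) : ℂ) * dzbar (fun w => (u w : ℂ)) z := by
    simpa using dzbar_ofReal_comp (hasDerivAt_neg (u z)).exp (h.differentiable_u z)
  have hcomm := dzbar_dz_eq_dz_dzbar (contDiff_dz h.smooth) z
  rw [funext h.dz_dz, funext h.dzbar_dz, dzbar_add (hdu.fun_smul (h.differentiable_dz z))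
      ((hφ.fun_mul hexpneg).fun_smul (h.differentiable_dzbar z)),
    dzbar_smul hdu (h.differentiable_dz z),
    dzbar_smul (hφ.fun_mul hexpneg) (h.differentiable_dzbar z), dzbar_mul hφ hexpneg,
    dz_smul hexp (h.differentiable z), hdexp, hdexpneg, h.dzbar_dz, h.dzbar_dzbar] at hcomm
  rw [← sub_eq_zero] at hcomm ⊢
  rw [← hcomm]
  module

theorem dzbar_cubicForm (z : ℂ) : dzbar φ z = 0 := by
  have hcompat := congrArg (fun X => herm X (dzbar F z)) (h.compatibility z)
  simp only [herm_add_left, herm_smul_left, h.conformal, h.metric_zbar] at hcompat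
  linear_combination hcompat - dzbar φ z * exp_neg_mul_exp (u z)

theorem gauss (z : ℂ) : dzbar (dz (fun w => (u w : ℂ))) z =
    (‖φ z‖ ^ 2 * Real.exp (-u z) ^ 2 - Real.exp (u z) : ℝ) := by
  have hcompat := congrArg (fun X => herm X (dz F z)) (h.compatibility z)
  have hnorm : φ z * star (φ z) = (‖φ z‖ ^ 2 : ℂ) := Complex.mul_conj' _
  simp only [herm_add_left, herm_smul_left, herm_eq_zero_comm.1 (h.conformal z), h.metric_z, hnorm,
    mul_zero, add_zero] at hcompat
  rw [← sub_eq_zero] at hcompat ⊢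
  simp only [Complex.ofReal_sub, Complex.ofReal_mul, Complex.ofReal_pow]
  linear_combination Real.exp (-u z) * hcompat - (dzbar (dz fun w => (u w : ℂ)) z -
    (‖φ z‖ ^ 2 * Real.exp (-u z) ^ 2 - Real.exp (u z) : ℂ)) * exp_neg_mul_exp (u z)

end IsMinimalLegendrian

theorem eq_of_dzbar_eq_zero_of_im_eq_zero {q : ℂ → ℂ} (hq : Differentiable ℝ q)
    (hdzbar : ∀ z, dzbar q z = 0) (him : ∀ z, (q z).im = 0) (z w : ℂ) : q z = q w := by
  have hstar : (fun w => star (q w)) = q := funext fun w => Complex.conj_eq_iff_im.2 (him w)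
  refine eq_of_dz_eq_zero_of_dzbar_eq_zero hq (fun z => ?_) hdzbar z w
  rw [← star_eq_zero, star_dz (hq z), hstar, hdzbar]

theorem IsMinimalLegendrian.eq_of_im_mul_cubicForm_eq_zero {F : ℂ → Fin 3 → ℂ} {u : ℂ → ℝ}
    {φ : ℂ → ℂ} (h : IsMinimalLegendrian F u φ) {c : ℂ} (hc : c ≠ 0)
    (him : ∀ z, (c * φ z).im = 0) (z w : ℂ) : φ z = φ w := by
  have hφ := h.differentiable_cubicForm
  refine mul_left_cancel₀ hc (eq_of_dzbar_eq_zero_of_im_eq_zero (q := fun z => c * φ z)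
    (fun z => (hφ z).const_mul c) (fun z => ?_) him z w)
  rw [dzbar_eq_wirtinger]
  exact (wirtinger_const_smul c (hφ z)).trans (by
    rw [← dzbar_eq_wirtinger, h.dzbar_cubicForm, smul_zero])

theorem exists_exp_half_eq (x : ℝ) : ∃ s : ℂ, s ≠ 0 ∧ star s = s ∧ Real.exp (x / 2) = s ∧
    Real.exp (-(x / 2)) = s⁻¹ ∧ Real.exp x = s ^ 2 ∧ Real.exp (-x) = (s ^ 2)⁻¹ := by
  have hsq : Real.exp x = Real.exp (x / 2) ^ 2 := by rw [sq, ← Real.exp_add, add_halves]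
  refine ⟨Real.exp (x / 2), Complex.ofReal_ne_zero.2 (Real.exp_ne_zero _), Complex.conj_ofReal _,
    rfl, ?_, ?_, ?_⟩
  · rw [Real.exp_neg, Complex.ofReal_inv]
  · rw [hsq, Complex.ofReal_pow]
  · rw [Real.exp_neg, hsq, Complex.ofReal_inv, Complex.ofReal_pow]

theorem ne_zero_of_norm_eq_one {lam : ℂ} (hlam : ‖lam‖ = 1) : lam ≠ 0 :=
  norm_ne_zero_iff.1 (hlam ▸ one_ne_zero)

theorem star_eq_inv {lam : ℂ} (hlam : ‖lam‖ = 1) : star lam = lam⁻¹ :=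
  (Complex.inv_eq_conj hlam).symm

theorem wirtinger_mul_exp_neg_half_smul {E : Type*} [NormedAddCommGroup E] [NormedSpace ℂ E]
    {G : ℂ → E} {u : ℂ → ℝ} {ε z : ℂ} (c : ℂ) (hu : DifferentiableAt ℝ u z)
    (hG : DifferentiableAt ℝ G z) :
    wirtinger ε (fun w => (c * Real.exp (-(u w / 2)) : ℂ) • G w) z =
      (c * Real.exp (-(u z / 2)) : ℂ) •
        (wirtinger ε G z - (wirtinger ε (fun w => (u w : ℂ)) z / 2) • G z) := by
  have hexp : DifferentiableAt ℝ (fun w => (Real.exp (-(u w / 2)) : ℂ)) z :=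
    Complex.ofRealCLM.differentiableAt.comp z (f := fun w => Real.exp (-(u w / 2))) (by fun_prop)
  have hderiv : wirtinger ε (fun w => (Real.exp (-(u w / 2)) : ℂ)) z =
      (Real.exp (-(u z / 2)) * -(1 / 2) : ℝ) * wirtinger ε (fun w => (u w : ℂ)) z :=
    wirtinger_ofReal_comp ((hasDerivAt_id _).div_const 2).neg.exp hu
  have hcexp := (wirtinger_const_smul (ε := ε) c hexp).trans (congrArg (c • ·) hderiv)
  rw [wirtinger_smul (hexp.const_mul c) hG]
  simp only [smul_eq_mul] at hcexp
  rw [hcexp]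
  push_cast
  module

theorem mul_frameU_apply (u : ℂ → ℝ) (ψ : ℂ → ℂ) (lam z : ℂ) (M : Matrix (Fin 3) (Fin 3) ℂ)
    (i : Fin 3) : (M * frameU u ψ lam z) i =
      ![dz (fun w => (u w : ℂ)) z / 2 * M i 0 - Complex.I * lam⁻¹ * ψ z * Real.exp (-u z) * M i 1,
        -dz (fun w => (u w : ℂ)) z / 2 * M i 1 + Complex.I * lam⁻¹ * Real.exp (u z / 2) * M i 2,
        Complex.I * lam⁻¹ * Real.exp (u z / 2) * M i 0] := by
  ext j
  fin_cases j <;>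
    simp [frameU, Matrix.mul_apply, Fin.sum_univ_three, -Complex.ofReal_exp] <;> ring

theorem mul_frameV_apply (u : ℂ → ℝ) (ψ : ℂ → ℂ) (lam z : ℂ) (M : Matrix (Fin 3) (Fin 3) ℂ)
    (i : Fin 3) : (M * frameV u ψ lam z) i =
      ![-dzbar (fun w => (u w : ℂ)) z / 2 * M i 0 + Complex.I * lam * Real.exp (u z / 2) * M i 2,
        dzbar (fun w => (u w : ℂ)) z / 2 * M i 1
          - Complex.I * lam * star (ψ z) * Real.exp (-u z) * M i 0,
        Complex.I * lam * Real.exp (u z / 2) * M i 1] := by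
  ext j
  fin_cases j <;>
    simp [frameV, Matrix.mul_apply, Fin.sum_univ_three, -Complex.ofReal_exp] <;> ring

theorem trace_frameU (u : ℂ → ℝ) (ψ : ℂ → ℂ) (lam z : ℂ) : (frameU u ψ lam z).trace = 0 := by
  simp only [frameU, Matrix.trace_fin_three, Matrix.add_apply, Matrix.smul_apply]
  simp [neg_div]

theorem trace_frameV (u : ℂ → ℝ) (ψ : ℂ → ℂ) (lam z : ℂ) : (frameV u ψ lam z).trace = 0 := by
  simp only [frameV, Matrix.trace_fin_three, Matrix.add_apply, Matrix.smul_apply]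
  simp [neg_div]

theorem exists_smul_mem_specialUnitaryGroup {n : Type*} [Fintype n] [DecidableEq n] [Nonempty n]
    {B : Matrix n n ℂ} (hB : B ∈ Matrix.unitaryGroup n ℂ) :
    ∃ μ : ℂ, μ ≠ 0 ∧ μ • B ∈ Matrix.specialUnitaryGroup n ℂ := by
  obtain ⟨μ, hμ⟩ := IsAlgClosed.exists_pow_nat_eq B.det⁻¹ (Fintype.card_pos (α := n))
  have hdet : ‖B.det‖ = 1 := CStarRing.norm_of_mem_unitary (Matrix.det_of_mem_unitary hB)
  have hnorm : ‖μ‖ = 1 := by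
    have hpow : ‖μ‖ ^ Fintype.card n = 1 := by rw [← norm_pow, hμ, norm_inv, hdet, inv_one]
    exact (pow_eq_one_iff_of_nonneg (norm_nonneg _) Fintype.card_ne_zero).1 hpow
  refine ⟨μ, ne_zero_of_norm_eq_one hnorm, Matrix.mem_specialUnitaryGroup_iff.2 ⟨?_, ?_⟩⟩
  · refine Unitary.smul_mem_of_mem (Unitary.mem_iff_star_mul_self.2 ?_) hB
    rw [star_eq_inv hnorm, inv_mul_cancel₀ (ne_zero_of_norm_eq_one hnorm)]
  · rw [Matrix.det_smul, hμ, inv_mul_cancel₀ (ne_zero_of_norm_eq_one hdet)]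

/-- The orthonormal frame `-iλ e^{-u/2} F_z`, `-iλ⁻¹ e^{-u/2} F_z̄`, `F` along a minimal Legendrian
map `F`. -/
noncomputable def legendrianFrame (F : ℂ → Fin 3 → ℂ) (u : ℂ → ℝ) (lam z : ℂ) :
    Fin 3 → Fin 3 → ℂ :=
  ![(-Complex.I * lam * Real.exp (-(u z / 2))) • dz F z,
    (-Complex.I * lam⁻¹ * Real.exp (-(u z / 2))) • dzbar F z, F z]

/-- The matrix whose columns are the vectors of `legendrianFrame`. -/
noncomputable def legendrianMatrix (F : ℂ → Fin 3 → ℂ) (u : ℂ → ℝ) (lam z : ℂ) :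
    Matrix (Fin 3) (Fin 3) ℂ :=
  (Matrix.of (legendrianFrame F u lam z))ᵀ

namespace IsMinimalLegendrian

variable {F : ℂ → Fin 3 → ℂ} {u : ℂ → ℝ} {φ ψ : ℂ → ℂ} {lam : ℂ}

theorem contDiff_legendrianMatrix (h : IsMinimalLegendrian F u φ) (i j : Fin 3) :
    ContDiff ℝ ∞ fun z => legendrianMatrix F u lam z i j := by
  have hexp : ContDiff ℝ ∞ fun z => (Real.exp (-(u z / 2)) : ℂ) :=
    Complex.ofRealCLM.contDiff.comp (h.contDiff_u.div_const 2).neg.exp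
  fin_cases j
  · exact (contDiff_const.mul hexp).mul (contDiff_pi.1 (contDiff_dz h.smooth) i)
  · exact (contDiff_const.mul hexp).mul (contDiff_pi.1 (contDiff_dzbar h.smooth) i)
  · exact contDiff_pi.1 h.smooth i

theorem differentiable_legendrianMatrix (h : IsMinimalLegendrian F u φ) (i j : Fin 3) :
    Differentiable ℝ fun z => legendrianMatrix F u lam z i j :=
  (h.contDiff_legendrianMatrix i j).differentiable (by simp)

theorem legendrianMatrix_mem_unitaryGroup (h : IsMinimalLegendrian F u φ) (hlam : ‖lam‖ = 1)
    (z : ℂ) : legendrianMatrix F u lam z ∈ Matrix.unitaryGroup (Fin 3) ℂ := by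
  refine IsHermOrthogonal.transpose_mem_unitaryGroup ?_
  have horth := (h.isHermOrthogonal z).smul ![-Complex.I * lam * Real.exp (-(u z / 2)),
    -Complex.I * lam⁻¹ * Real.exp (-(u z / 2)), 1]
  have hl := ne_zero_of_norm_eq_one hlam
  have hlinv : star lam⁻¹ = lam := by rw [star_inv₀, star_eq_inv hlam, inv_inv]
  convert horth using 1
  · funext i
    fin_cases i <;> simp [legendrianFrame]
  · obtain ⟨s, hs, hstar, -, hneghalf, hexp, -⟩ := exists_exp_half_eq (u z)
    have hI : star Complex.I = -Complex.I := Complex.conj_I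
    funext i
    fin_cases i <;>
    simp only [Fin.zero_eta, Fin.mk_one, Fin.reduceFinMk, Matrix.cons_val, Pi.one_apply, hneghalf,
        hexp, star_mul', star_neg, star_inv₀, hstar, hlinv, hI, star_eq_inv hlam, star_one, one_mul]
    · field_simp
      simp
    · field_simp
      simp

theorem wirtinger_legendrianMatrix_apply (h : IsMinimalLegendrian F u φ) (ε z : ℂ) (i j : Fin 3) :
    wirtinger ε (fun w => legendrianMatrix F u lam w i j) z =
      wirtinger ε (fun w => legendrianFrame F u lam w j) z i :=
  (wirtinger_apply (differentiableAt_pi.2 fun i => h.differentiable_legendrianMatrix i j z) i).symm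

theorem dz_legendrianMatrix
    (h : IsMinimalLegendrian F u fun z => -Complex.I * (lam ^ (-3 : ℤ) * ψ z)) (hl : lam ≠ 0)
    (z : ℂ) (i j : Fin 3) :
    dz (fun w => legendrianMatrix F u lam w i j) z =
      (legendrianMatrix F u lam z * frameU u ψ lam z) i j := by
  have hu := h.differentiable_u z
  obtain ⟨s, hs, -, hhalf, hneghalf, hexp, hneg⟩ := exists_exp_half_eq (u z)
  rw [dz_eq_wirtinger, h.wirtinger_legendrianMatrix_apply, mul_frameU_apply]
  simp only [legendrianMatrix, legendrianFrame, hhalf, hneghalf, hneg, Matrix.transpose_apply,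
    Matrix.of_apply]
  fin_cases j
  · refine (congrFun (wirtinger_mul_exp_neg_half_smul _ hu (h.differentiable_dz z)) i).trans ?_
    simp only [← dz_eq_wirtinger, h.dz_dz, hneghalf, hneg, Fin.zero_eta,
      Matrix.cons_val, Pi.smul_apply, Pi.sub_apply, Pi.add_apply, smul_eq_mul]
    field_simp
    ring
  · refine (congrFun (wirtinger_mul_exp_neg_half_smul _ hu (h.differentiable_dzbar z)) i).trans ?_
    simp only [← dz_eq_wirtinger, h.dz_dzbar, hneghalf, hexp, Fin.mk_one,
      Matrix.cons_val, Pi.smul_apply, Pi.sub_apply, smul_eq_mul]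
    field_simp
    ring
  · refine (congrFun (congrFun (dz_eq_wirtinger F) z) i).symm.trans ?_
    simp only [Fin.reduceFinMk, Matrix.cons_val, Pi.smul_apply, smul_eq_mul]
    field_simp
    rw [Complex.I_sq]
    ring

theorem dzbar_legendrianMatrix
    (h : IsMinimalLegendrian F u fun z => -Complex.I * (lam ^ (-3 : ℤ) * ψ z)) (hlam : ‖lam‖ = 1)
    (z : ℂ) (i j : Fin 3) :
    dzbar (fun w => legendrianMatrix F u lam w i j) z =
      (legendrianMatrix F u lam z * frameV u ψ lam z) i j := by
  have hl := ne_zero_of_norm_eq_one hlam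
  have hI : star Complex.I = -Complex.I := Complex.conj_I
  have hu := h.differentiable_u z
  obtain ⟨s, hs, -, hhalf, hneghalf, hexp, hneg⟩ := exists_exp_half_eq (u z)
  rw [dzbar_eq_wirtinger, h.wirtinger_legendrianMatrix_apply, mul_frameV_apply]
  simp only [legendrianMatrix, legendrianFrame, hhalf, hneghalf, hneg, Matrix.transpose_apply,
    Matrix.of_apply]
  fin_cases j
  · refine (congrFun (wirtinger_mul_exp_neg_half_smul _ hu (h.differentiable_dz z)) i).trans ?_
    simp only [← dzbar_eq_wirtinger, h.dzbar_dz, hneghalf, hexp, Fin.zero_eta,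
      Matrix.cons_val, Pi.smul_apply, Pi.sub_apply, smul_eq_mul]
    field_simp
    ring
  · refine (congrFun (wirtinger_mul_exp_neg_half_smul _ hu (h.differentiable_dzbar z)) i).trans ?_
    simp only [← dzbar_eq_wirtinger, h.dzbar_dzbar, hneghalf, hneg, star_mul', star_zpow₀,
      star_neg, hI, star_eq_inv hlam, Fin.mk_one, Matrix.cons_val, Pi.smul_apply, Pi.sub_apply,
      Pi.add_apply, smul_eq_mul]
    field_simp
    ring
  · change dzbar F z i = _
    simp only [Fin.reduceFinMk, Matrix.cons_val, Pi.smul_apply, smul_eq_mul]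
    field_simp
    rw [Complex.I_sq]
    ring

theorem det_legendrianMatrix
    (h : IsMinimalLegendrian F u fun z => -Complex.I * (lam ^ (-3 : ℤ) * ψ z)) (hlam : ‖lam‖ = 1)
    (z w : ℂ) : (legendrianMatrix F u lam z).det = (legendrianMatrix F u lam w).det := by
  have hΨ := fun z i j => h.differentiable_legendrianMatrix (lam := lam) i j z
  refine eq_of_dz_eq_zero_of_dzbar_eq_zero (G := fun z => (legendrianMatrix F u lam z).det)
    (fun z => ?_) (fun z => ?_) (fun z => ?_) z w
  · simp only [Matrix.det_fin_three]
    have := hΨ z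
    fun_prop
  · have hdz := h.dz_legendrianMatrix (ne_zero_of_norm_eq_one hlam) z
    simp only [dz_eq_wirtinger] at hdz ⊢
    rw [wirtinger_det_of_eq_mul (hΨ z) hdz, trace_frameU, zero_mul]
  · rw [dzbar_eq_wirtinger, wirtinger_det_of_eq_mul (hΨ z) (h.dzbar_legendrianMatrix hlam z),
      trace_frameV, zero_mul]

theorem isExtendedFrame
    (h : IsMinimalLegendrian F u fun z => -Complex.I * (lam ^ (-3 : ℤ) * ψ z))
    (hlam : ‖lam‖ = 1) :
    IsExtendedFrame u ψ lam fun z =>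
      (legendrianMatrix F u lam 0)ᴴ * legendrianMatrix F u lam z := by
  have hmem := h.legendrianMatrix_mem_unitaryGroup hlam
  have hΨ := fun z i j => h.differentiable_legendrianMatrix (lam := lam) i j z
  have hone := Matrix.mem_unitaryGroup_iff'.1 (hmem 0)
  rw [Matrix.star_eq_conjTranspose] at hone
  refine ⟨fun z => ?_, fun i j => ?_, fun z i j => ?_, fun z i j => ?_, hone⟩
  · refine Matrix.mem_specialUnitaryGroup_iff.2 ⟨mul_mem (Unitary.star_mem (hmem 0)) (hmem z), ?_⟩
    rw [Matrix.det_mul, h.det_legendrianMatrix hlam z 0, ← Matrix.det_mul, hone, Matrix.det_one]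
  · simp only [Matrix.mul_apply]
    exact ContDiff.sum fun k _ => contDiff_const.mul (h.contDiff_legendrianMatrix k j)
  · rw [dz_eq_wirtinger, wirtinger_const_mul_matrix_apply _ (hΨ z), Matrix.mul_assoc,
      Matrix.mul_apply]
    simp only [← dz_eq_wirtinger, h.dz_legendrianMatrix (ne_zero_of_norm_eq_one hlam)]
  · rw [dzbar_eq_wirtinger, wirtinger_const_mul_matrix_apply _ (hΨ z), Matrix.mul_assoc,
      Matrix.mul_apply]
    simp only [← dzbar_eq_wirtinger, h.dzbar_legendrianMatrix hlam]

theorem exists_isCanonicalLift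
    (h : IsMinimalLegendrian F u fun z => -Complex.I * (lam ^ (-3 : ℤ) * ψ z)) (hlam : ‖lam‖ = 1)
    {f : ℂ → CP2} (hf : IsHorizontalLift f F) : ∃ G, IsCanonicalLift f u ψ lam G := by
  let B := legendrianMatrix F u lam 0
  have hB : B * Bᴴ = 1 :=
    Matrix.mem_unitaryGroup_iff.1 (h.legendrianMatrix_mem_unitaryGroup hlam 0)
  obtain ⟨μ, hμ0, hμ⟩ := exists_smul_mem_specialUnitaryGroup
    (h.legendrianMatrix_mem_unitaryGroup hlam 0)
  obtain ⟨hmem, hdet⟩ := Matrix.mem_specialUnitaryGroup_iff.1 hμ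
  let A : Matrix.SpecialLinearGroup (Fin 3) ℂ := ⟨μ • B, hdet⟩
  have hA : ∀ z, A • (Bᴴ *ᵥ F z) = μ • F z := fun z => by
    change (μ • B) *ᵥ (Bᴴ *ᵥ F z) = μ • F z
    rw [Matrix.smul_mulVec, Matrix.mulVec_mulVec, hB, Matrix.one_mulVec]
  have hne : ∀ z, Bᴴ *ᵥ F z ≠ 0 := fun z hz => by
    obtain ⟨hF, -⟩ := hf.lift z
    have hzero := hA z
    rw [hz, smul_zero] at hzero
    exact smul_ne_zero hμ0 hF hzero.symm
  refine ⟨fun z => Bᴴ *ᵥ F z, ⟨_, h.isExtendedFrame hlam, fun _ _ => rfl⟩, A, hmem,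
    fun z => ⟨hne z, ?_⟩⟩
  obtain ⟨hF, hlift⟩ := hf.lift z
  rw [← hlift, Projectivization.smul_mk, Projectivization.mk_eq_mk_iff']
  exact ⟨μ⁻¹, by rw [hA, inv_smul_smul₀ hμ0]⟩

end IsMinimalLegendrian

section Elliptic

variable {k : ℝ}

theorem one_sub_sq_mul_sin_sq_pos (hk : k ^ 2 < 1) (θ : ℝ) : 0 < 1 - k ^ 2 * Real.sin θ ^ 2 :=
  sub_pos.2 ((mul_le_of_le_one_right (sq_nonneg k) (Real.sin_sq_le_one θ)).trans_lt hk)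

theorem hasDerivAt_ellipticJ (hk : k ^ 2 < 1) (θ : ℝ) : HasDerivAt (fun θ => ellipticJ θ k)
    (1 / Real.sqrt (1 - k ^ 2 * Real.sin θ ^ 2)) θ := by
  have hcont : Continuous fun α : ℝ => 1 / Real.sqrt (1 - k ^ 2 * Real.sin α ^ 2) :=
    continuous_const.div (by fun_prop) fun α =>
      (Real.sqrt_pos.2 (one_sub_sq_mul_sin_sq_pos hk α)).ne'
  exact (hcont.integral_hasStrictDerivAt 0 θ).hasDerivAt

theorem continuous_ellipticJ (hk : k ^ 2 < 1) : Continuous fun θ => ellipticJ θ k :=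
  continuous_iff_continuousAt.2 fun θ => (hasDerivAt_ellipticJ hk θ).continuousAt

theorem strictMono_ellipticJ (hk : k ^ 2 < 1) : StrictMono fun θ => ellipticJ θ k :=
  strictMono_of_hasDerivAt_pos (hasDerivAt_ellipticJ hk) fun θ =>
    one_div_pos.2 (Real.sqrt_pos.2 (one_sub_sq_mul_sin_sq_pos hk θ))

theorem ellipticJ_zero : ellipticJ 0 k = 0 :=
  intervalIntegral.integral_same

theorem ellipticK_pos (hk : k ^ 2 < 1) : 0 < ellipticK k :=
  ellipticJ_zero.symm.trans_lt (strictMono_ellipticJ hk Real.pi_div_two_pos)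

theorem monotone_ellipticJ_sub (hk : k ^ 2 < 1) : Monotone fun θ => ellipticJ θ k - θ := by
  have hderiv : ∀ θ, HasDerivAt (fun θ => ellipticJ θ k - θ)
      (1 / Real.sqrt (1 - k ^ 2 * Real.sin θ ^ 2) - 1) θ := fun θ =>
    (hasDerivAt_ellipticJ hk θ).sub (hasDerivAt_id θ)
  refine monotone_of_hasDerivAt_nonneg hderiv fun θ => ?_
  refine sub_nonneg.2 ((one_le_div (Real.sqrt_pos.2 (one_sub_sq_mul_sin_sq_pos hk θ))).2 ?_)
  exact Real.sqrt_le_one.2 (sub_le_self _ (by positivity))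

theorem surjective_ellipticJ (hk : k ^ 2 < 1) : Function.Surjective fun θ => ellipticJ θ k := by
  have hmono := monotone_ellipticJ_sub hk
  refine (continuous_ellipticJ hk).surjective ?_ ?_
  · refine Filter.tendsto_atTop_mono' _ ?_ Filter.tendsto_id
    filter_upwards [Filter.eventually_ge_atTop 0] with θ hθ
    simpa [ellipticJ_zero] using hmono hθ
  · refine Filter.tendsto_atBot_mono' _ ?_ Filter.tendsto_id
    filter_upwards [Filter.eventually_le_atBot 0] with θ hθ
    simpa [ellipticJ_zero] using hmono hθ

theorem ellipticJ_pi_sub (hk : k ^ 2 < 1) (θ : ℝ) :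
    ellipticJ (Real.pi - θ) k = 2 * ellipticK k - ellipticJ θ k := by
  have hderiv : ∀ θ, HasDerivAt (fun θ => ellipticJ (Real.pi - θ) k + ellipticJ θ k) 0 θ :=
    fun θ => (((hasDerivAt_ellipticJ hk (Real.pi - θ)).comp_const_sub Real.pi θ).add
      (hasDerivAt_ellipticJ hk θ)).congr_deriv (by rw [Real.sin_pi_sub, neg_add_cancel])
  have hconst := is_const_of_deriv_eq_zero (fun θ => (hderiv θ).differentiableAt)
    (fun θ => (hderiv θ).deriv) θ (Real.pi / 2)
  rw [sub_half] at hconst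
  rw [ellipticK]
  linarith

theorem ellipticJ_neg (θ : ℝ) : ellipticJ (-θ) k = -ellipticJ θ k := by
  have hcomp := intervalIntegral.integral_comp_neg (a := 0) (b := θ)
    fun α => 1 / Real.sqrt (1 - k ^ 2 * Real.sin α ^ 2)
  simp only [Real.sin_neg, neg_sq, neg_zero] at hcomp
  rw [ellipticJ, intervalIntegral.integral_symm, ← hcomp, ellipticJ]

theorem ellipticJ_add_two_pi (hk : k ^ 2 < 1) (θ : ℝ) :
    ellipticJ (θ + 2 * Real.pi) k = ellipticJ θ k + 4 * ellipticK k := by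
  have hpi : ∀ θ, ellipticJ (Real.pi + θ) k = 2 * ellipticK k + ellipticJ θ k := fun θ => by
    rw [← sub_neg_eq_add, ellipticJ_pi_sub hk, ellipticJ_neg, sub_neg_eq_add]
  rw [show θ + 2 * Real.pi = Real.pi + (Real.pi + θ) by ring, hpi, hpi]
  ring

theorem jacobiAm_ellipticJ (hk : k ^ 2 < 1) (θ : ℝ) : jacobiAm (ellipticJ θ k) k = θ :=
  Function.leftInverse_invFun (strictMono_ellipticJ hk).injective θ

theorem ellipticJ_jacobiAm (hk : k ^ 2 < 1) (x : ℝ) : ellipticJ (jacobiAm x k) k = x :=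
  Function.rightInverse_invFun (surjective_ellipticJ hk) x

theorem jacobiAm_zero (hk : k ^ 2 < 1) : jacobiAm 0 k = 0 := by
  simpa only [ellipticJ_zero] using jacobiAm_ellipticJ hk 0

theorem jacobiAm_add_four_mul_ellipticK (hk : k ^ 2 < 1) (x : ℝ) :
    jacobiAm (x + 4 * ellipticK k) k = jacobiAm x k + 2 * Real.pi := by
  rw [← jacobiAm_ellipticJ hk (jacobiAm x k + 2 * Real.pi), ellipticJ_add_two_pi hk,
    ellipticJ_jacobiAm hk]

theorem continuous_jacobiAm (hk : k ^ 2 < 1) : Continuous fun x => jacobiAm x k := by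
  let e := (strictMono_ellipticJ hk).orderIsoOfSurjective _ (surjective_ellipticJ hk)
  have he : (fun x => jacobiAm x k) = e.symm := funext fun x =>
    e.injective ((ellipticJ_jacobiAm hk x).trans (e.apply_symm_apply x).symm)
  exact he ▸ e.symm.continuous

theorem hasDerivAt_jacobiAm (hk : k ^ 2 < 1) (x : ℝ) :
    HasDerivAt (fun x => jacobiAm x k) (jacobiDn x k) x := by
  have hsqrt := Real.sqrt_pos.2 (one_sub_sq_mul_sin_sq_pos hk (jacobiAm x k))
  have hderiv := HasDerivAt.of_local_left_inverse (continuous_jacobiAm hk).continuousAt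
    (hasDerivAt_ellipticJ hk (jacobiAm x k)) (one_div_pos.2 hsqrt).ne'
    (Filter.Eventually.of_forall (ellipticJ_jacobiAm hk))
  rwa [one_div, inv_inv] at hderiv

theorem jacobiDn_pos (hk : k ^ 2 < 1) (x : ℝ) : 0 < jacobiDn x k :=
  Real.sqrt_pos.2 (one_sub_sq_mul_sin_sq_pos hk _)

theorem jacobiDn_sq (hk : k ^ 2 < 1) (x : ℝ) : jacobiDn x k ^ 2 = 1 - k ^ 2 * jacobiSn x k ^ 2 :=
  Real.sq_sqrt (one_sub_sq_mul_sin_sq_pos hk _).le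

theorem jacobiCn_sq (x : ℝ) : jacobiCn x k ^ 2 = 1 - jacobiSn x k ^ 2 :=
  Real.cos_sq' _

theorem hasDerivAt_jacobiSn (hk : k ^ 2 < 1) (x : ℝ) :
    HasDerivAt (fun x => jacobiSn x k) (jacobiCn x k * jacobiDn x k) x :=
  (hasDerivAt_jacobiAm hk x).sin

theorem hasDerivAt_jacobiCn (hk : k ^ 2 < 1) (x : ℝ) :
    HasDerivAt (fun x => jacobiCn x k) (-(jacobiSn x k * jacobiDn x k)) x :=
  (hasDerivAt_jacobiAm hk x).cos.congr_deriv (neg_mul _ _)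

theorem hasDerivAt_jacobiDn (hk : k ^ 2 < 1) (x : ℝ) :
    HasDerivAt (fun x => jacobiDn x k) (-(k ^ 2 * (jacobiSn x k * jacobiCn x k))) x := by
  have hderiv := ((((hasDerivAt_jacobiSn hk x).fun_pow 2).const_mul (k ^ 2)).const_sub 1).sqrt
    (one_sub_sq_mul_sin_sq_pos hk _).ne'
  refine hderiv.congr_deriv ?_
  have hdn := (jacobiDn_pos hk x).ne'
  rw [show Real.sqrt (1 - k ^ 2 * jacobiSn x k ^ 2) = jacobiDn x k from rfl]
  field_simp
  ring

theorem jacobiSn_zero (hk : k ^ 2 < 1) : jacobiSn 0 k = 0 := by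
  rw [jacobiSn, jacobiAm_zero hk, Real.sin_zero]

theorem jacobiCn_zero (hk : k ^ 2 < 1) : jacobiCn 0 k = 1 := by
  rw [jacobiCn, jacobiAm_zero hk, Real.cos_zero]

theorem jacobiDn_zero (hk : k ^ 2 < 1) : jacobiDn 0 k = 1 := by
  rw [jacobiDn, jacobiAm_zero hk, Real.sin_zero, sq 0, zero_mul, mul_zero, sub_zero, Real.sqrt_one]

/-- The Jacobi functions `sn`, `cn`, `dn`, indexed by `Fin 3`. -/
noncomputable def jacobi (j : Fin 3) (x k : ℝ) : ℝ :=
  ![jacobiSn x k, jacobiCn x k, jacobiDn x k] j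

/-- The derivatives of `sn`, `cn`, `dn` with respect to the argument. -/
noncomputable def jacobiDeriv (j : Fin 3) (x k : ℝ) : ℝ :=
  ![jacobiCn x k * jacobiDn x k, -(jacobiSn x k * jacobiDn x k),
    -(k ^ 2 * (jacobiSn x k * jacobiCn x k))] j

/-- The constants `h` for which `sn`, `cn`, `dn` solve Lamé's equation
`g'' = (2 k² sn² - h) g`. -/
noncomputable def lameEigenvalue (j : Fin 3) (k : ℝ) : ℝ := ![1 + k ^ 2, 1, k ^ 2] j

theorem hasDerivAt_jacobi (hk : k ^ 2 < 1) (j : Fin 3) (x : ℝ) :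
    HasDerivAt (fun x => jacobi j x k) (jacobiDeriv j x k) x := by
  fin_cases j
  exacts [hasDerivAt_jacobiSn hk x, hasDerivAt_jacobiCn hk x, hasDerivAt_jacobiDn hk x]

theorem hasDerivAt_jacobiDeriv (hk : k ^ 2 < 1) (j : Fin 3) (x : ℝ) :
    HasDerivAt (fun x => jacobiDeriv j x k)
      ((2 * k ^ 2 * jacobiSn x k ^ 2 - lameEigenvalue j k) * jacobi j x k) x := by
  have hsn := hasDerivAt_jacobiSn hk x
  have hcn := hasDerivAt_jacobiCn hk x
  have hdn := hasDerivAt_jacobiDn hk x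
  have hcn2 := jacobiCn_sq (k := k) x
  have hdn2 := jacobiDn_sq hk x
  fin_cases j
  · refine (hcn.mul hdn).congr_deriv ?_
    change _ = (2 * k ^ 2 * jacobiSn x k ^ 2 - (1 + k ^ 2)) * jacobiSn x k
    linear_combination -jacobiSn x k * hdn2 - k ^ 2 * jacobiSn x k * hcn2
  · refine (hsn.mul hdn).neg.congr_deriv ?_
    change _ = (2 * k ^ 2 * jacobiSn x k ^ 2 - 1) * jacobiCn x k
    linear_combination -jacobiCn x k * hdn2
  · refine ((hsn.mul hcn).const_mul (k ^ 2)).neg.congr_deriv ?_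
    change _ = (2 * k ^ 2 * jacobiSn x k ^ 2 - k ^ 2) * jacobiDn x k
    linear_combination -(k ^ 2 * jacobiDn x k) * hcn2

theorem jacobi_zero (hk : k ^ 2 < 1) (j : Fin 3) : jacobi j 0 k = ![0, 1, 1] j := by
  rw [jacobi, jacobiSn_zero hk, jacobiCn_zero hk, jacobiDn_zero hk]

theorem jacobiDeriv_zero (hk : k ^ 2 < 1) (j : Fin 3) : jacobiDeriv j 0 k = ![1, 0, 0] j := by
  rw [jacobiDeriv, jacobiSn_zero hk, jacobiCn_zero hk, jacobiDn_zero hk]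
  simp only [mul_one, mul_zero, neg_zero]

theorem jacobi_add_four_mul_ellipticK (hk : k ^ 2 < 1) (j : Fin 3) (x : ℝ) :
    jacobi j (x + 4 * ellipticK k) k = jacobi j x k := by
  simp only [jacobi, jacobiSn, jacobiCn, jacobiDn, jacobiAm_add_four_mul_ellipticK hk,
    Real.sin_add_two_pi, Real.cos_add_two_pi]

theorem exists_forall_jacobi_ne_zero (hk : k ^ 2 < 1) : ∃ x, ∀ j, jacobi j x k ≠ 0 := by
  have ham := jacobiAm_ellipticJ hk (Real.pi / 4)
  have hsqrt : Real.sqrt 2 / 2 ≠ 0 := by positivity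
  refine ⟨ellipticJ (Real.pi / 4) k, fun j => ?_⟩
  fin_cases j
  · exact ((congrArg Real.sin ham).trans Real.sin_pi_div_four).trans_ne hsqrt
  · exact ((congrArg Real.cos ham).trans Real.cos_pi_div_four).trans_ne hsqrt
  · exact (jacobiDn_pos hk _).ne'

end Elliptic

theorem eq_zero_of_hasDerivAt_smul {E : Type*} [NormedAddCommGroup E] [NormedSpace ℝ E]
    {q : ℝ → ℝ} (hq : Continuous q) {e e' : ℝ → E} (he : ∀ t, HasDerivAt e (e' t) t)
    (he' : ∀ t, HasDerivAt e' (q t • e t) t) (h0 : e 0 = 0) (h0' : e' 0 = 0) (t : ℝ) :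
    e t = 0 := by
  obtain ⟨R, hR, ht⟩ : ∃ R, 0 < R ∧ t ∈ Set.Ioo (-R) R :=
    ⟨|t| + 1, by positivity, abs_lt.1 (lt_add_one _)⟩
  obtain ⟨C, hC⟩ := isCompact_Icc.exists_bound_of_continuousOn (hq.continuousOn (s := .Icc (-R) R))
  have hlip : ∀ s ∈ Set.Ioo (-R) R, LipschitzOnWith (max 1 C.toNNReal)
      (fun x : E × E => (x.2, q s • x.1)) Set.univ := fun s hs => by
    have hnorm : ‖q s‖₊ * 1 ≤ C.toNNReal :=
      (mul_one _).trans_le (NNReal.le_toNNReal_of_coe_le (hC s (Set.Ioo_subset_Icc_self hs)))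
    exact ((LipschitzWith.prod_snd.prodMk ((lipschitzWith_smul (q s)).comp
      LipschitzWith.prod_fst)).weaken (max_le_max le_rfl hnorm)).lipschitzOnWith
  have hzero : ∀ s, HasDerivAt (fun _ : ℝ => (0 : E × E)) ((0 : E), q s • (0 : E)) s := fun s =>
    (hasDerivAt_const s (0 : E × E)).congr_deriv (by rw [smul_zero]; rfl)
  have heq := ODE_solution_unique_of_mem_Ioo (t₀ := 0) hlip ⟨neg_lt_zero.2 hR, hR⟩
    (fun s _ => ⟨(he s).prodMk (he' s), trivial⟩) (fun s _ => ⟨hzero s, trivial⟩)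
    (Prod.ext h0 h0')
  exact congrArg Prod.fst (heq ht)

/-- The function `v` with derivative `v'` has its maximum at `0` and solves the Gauss equation of a
metric `2 e^v dz dz̄` which depends on `y` only and whose cubic form has constant norm `p`. -/
structure IsGaussSolution (p : ℝ) (v v' : ℝ → ℝ) : Prop where
  hasDerivAt : ∀ y, HasDerivAt v (v' y) y
  hasDerivAt_deriv :
    ∀ y, HasDerivAt v' (4 * (p ^ 2 * Real.exp (-v y) ^ 2 - Real.exp (v y))) y
  le_zero : ∀ y, v y ≤ v 0

/-- The constants of the profile `a₁ - (a₁ - a₂) sn²(r y, k)` of the metric. The numbers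
`a₁ > a₂ > 0 > -a₃` are the roots of `w³ - (a₁ + a₂ - a₃) w² + p² / 2`, and `sq_p`, `mul_eq` are
equivalent to the formulas for its coefficients. -/
structure IsProfile (a₁ a₂ a₃ p k r : ℝ) : Prop where
  pos₂ : 0 < a₂
  pos₃ : 0 < a₃
  lt : a₂ < a₁
  sq_p : p ^ 2 = 2 * a₁ ^ 2 * (a₂ - a₃)
  mul_eq : a₂ * a₃ = a₁ * (a₂ - a₃)
  sq_k : k ^ 2 * (a₁ + a₃) = a₁ - a₂
  pos_r : 0 < r
  sq_r : r ^ 2 = 2 * (a₁ + a₃)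

namespace IsProfile

variable {a₁ a₂ a₃ p k r : ℝ}

theorem of_formula {β : ℝ} (h₁ : 0 < a₁) (hp : p ≠ 0) (hlt : p ^ 2 < a₁ ^ 3)
    (hβ : β = 2 * a₁ + p ^ 2 / a₁ ^ 2)
    (ha₂ : a₂ = (β / 2 - a₁ + Real.sqrt ((β / 2 - a₁) ^ 2 + 4 * a₁ * (β / 2 - a₁))) / 2)
    (ha₃ : a₃ = (-(β / 2 - a₁) + Real.sqrt ((β / 2 - a₁) ^ 2 + 4 * a₁ * (β / 2 - a₁))) / 2)
    (hk : k = Real.sqrt ((a₁ - a₂) / (a₁ + a₃))) (hr : r = Real.sqrt (2 * (a₁ + a₃))) :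
    IsProfile a₁ a₂ a₃ p k r := by
  obtain ⟨s, hs⟩ : ∃ s, s = β / 2 - a₁ := ⟨_, rfl⟩
  rw [← hs] at ha₂ ha₃
  have hsp : s = p ^ 2 / (2 * a₁ ^ 2) := by rw [hs, hβ]; field_simp; ring
  have hs0 : 0 < s := by rw [hsp]; positivity
  have hsa : 2 * s < a₁ := by
    refine lt_of_mul_lt_mul_right ?_ (sq_nonneg a₁)
    calc 2 * s * a₁ ^ 2 = p ^ 2 := by rw [hsp]; field_simp
      _ < a₁ ^ 3 := hlt
      _ = a₁ * a₁ ^ 2 := pow_succ' _ _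
  have hq2 := Real.sq_sqrt (show 0 ≤ s ^ 2 + 4 * a₁ * s by positivity)
  generalize hq : Real.sqrt (s ^ 2 + 4 * a₁ * s) = q at *
  have hq0 : 0 ≤ q := hq ▸ Real.sqrt_nonneg _
  have hsq : s < q := lt_of_pow_lt_pow_left₀ 2 hq0 (by nlinarith)
  have hqa : q < 2 * a₁ - s := lt_of_pow_lt_pow_left₀ 2 (by linarith) (by nlinarith)
  have h₃ : 0 < a₃ := by linarith
  have h₂₁ : a₂ < a₁ := by linarith
  have hdiv : 0 < (a₁ - a₂) / (a₁ + a₃) := div_pos (by linarith) (by positivity)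
  refine ⟨by linarith, h₃, h₂₁, ?_, ?_, ?_, by rw [hr]; positivity, ?_⟩
  · rw [ha₂, ha₃, hsp]; field_simp; ring
  · rw [ha₂, ha₃]; linear_combination hq2 / 4
  · rw [hk, Real.sq_sqrt hdiv.le, div_mul_cancel₀ _ (by positivity)]
  · rw [hr, Real.sq_sqrt (by positivity)]

section

variable (H : IsProfile a₁ a₂ a₃ p k r)
include H

theorem pos₁ : 0 < a₁ := H.pos₂.trans H.lt

theorem sq_k_lt_one : k ^ 2 < 1 := by
  nlinarith [H.sq_k, H.pos₁, H.pos₂, H.pos₃]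

theorem hasDerivAt_jacobi (j : Fin 3) (y : ℝ) :
    HasDerivAt (fun y => jacobi j (r * y) k) (r * jacobiDeriv j (r * y) k) y := by
  have hmul : HasDerivAt (fun y => r * y) r y := hasDerivAt_const_mul r
  exact ((MinLag.hasDerivAt_jacobi H.sq_k_lt_one j (r * y)).comp y hmul).congr_deriv (mul_comm _ _)

theorem hasDerivAt_jacobiDeriv (j : Fin 3) (y : ℝ) :
    HasDerivAt (fun y => r * jacobiDeriv j (r * y) k)
      (r ^ 2 * (2 * k ^ 2 * jacobiSn (r * y) k ^ 2 - lameEigenvalue j k) * jacobi j (r * y) k)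
      y := by
  have hmul : HasDerivAt (fun y => r * y) r y := hasDerivAt_const_mul r
  refine (((MinLag.hasDerivAt_jacobiDeriv H.sq_k_lt_one j (r * y)).comp y hmul).const_mul
    r).congr_deriv ?_
  ring

theorem sq_mul_sub_lameEigenvalue_eq {d : ℝ} {j : Fin 3}
    (hd : r ^ 2 * lameEigenvalue j k = 4 * a₁ - d ^ 2) (s : ℝ) :
    r ^ 2 * (2 * k ^ 2 * s ^ 2 - lameEigenvalue j k) = d ^ 2 - 4 * (a₁ - (a₁ - a₂) * s ^ 2) := by
  linear_combination -hd + 2 * k ^ 2 * s ^ 2 * H.sq_r + 4 * s ^ 2 * H.sq_k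

theorem continuous_jacobiSn : Continuous fun y => jacobiSn (r * y) k :=
  continuous_iff_continuousAt.2 fun y => (H.hasDerivAt_jacobi 0 y).continuousAt

theorem hasDerivAt_profile (y : ℝ) :
    HasDerivAt (fun y => a₁ - (a₁ - a₂) * jacobiSn (r * y) k ^ 2)
      (-2 * (a₁ - a₂) * (jacobiSn (r * y) k * (r * jacobiDeriv 0 (r * y) k))) y := by
  refine ((((H.hasDerivAt_jacobi 0 y).fun_pow 2).const_mul (a₁ - a₂)).const_sub a₁).congr_deriv ?_
  simp only [jacobi, Matrix.cons_val_zero]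
  ring

theorem hasDerivAt_profile_deriv (y : ℝ) :
    HasDerivAt (fun y => -2 * (a₁ - a₂) * (jacobiSn (r * y) k * (r * jacobiDeriv 0 (r * y) k)))
      (8 * (a₁ + a₂ - a₃) * (a₁ - (a₁ - a₂) * jacobiSn (r * y) k ^ 2) -
        12 * (a₁ - (a₁ - a₂) * jacobiSn (r * y) k ^ 2) ^ 2) y := by
  refine (((H.hasDerivAt_jacobi 0 y).mul (H.hasDerivAt_jacobiDeriv 0 y)).const_mul
    (-2 * (a₁ - a₂))).congr_deriv ?_
  have hderiv_sq : jacobiDeriv 0 (r * y) k ^ 2 =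
      (1 - jacobiSn (r * y) k ^ 2) * (1 - k ^ 2 * jacobiSn (r * y) k ^ 2) := by
    rw [← jacobiCn_sq, ← jacobiDn_sq H.sq_k_lt_one]
    exact mul_pow _ _ _
  simp only [jacobi, lameEigenvalue, Matrix.cons_val_zero]
  generalize jacobiSn (r * y) k = s at *
  generalize jacobiDeriv 0 (r * y) k = s' at *
  linear_combination -2 * (a₁ - a₂) * r ^ 2 * hderiv_sq -
    2 * (a₁ - a₂) * (1 - 2 * (1 + k ^ 2) * s ^ 2 + 3 * k ^ 2 * s ^ 4) * H.sq_r +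
    4 * (a₁ - a₂) * (2 * s ^ 2 - 3 * s ^ 4) * H.sq_k + 4 * H.mul_eq

end

end IsProfile

namespace IsGaussSolution

variable {p : ℝ} {v v' : ℝ → ℝ} (h : IsGaussSolution p v v')
include h

theorem deriv_zero : v' 0 = 0 :=
  IsLocalMax.hasDerivAt_eq_zero (Filter.Eventually.of_forall h.le_zero) (h.hasDerivAt 0)

theorem first_integral (y : ℝ) :
    v' y ^ 2 * Real.exp (v y) ^ 2 = -8 * (Real.exp (v y) - Real.exp (v 0)) * (Real.exp (v y) ^ 2 -
      p ^ 2 / (2 * Real.exp (v 0) ^ 2) * (Real.exp (v y) + Real.exp (v 0))) := by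
  have henergy : ∀ y, HasDerivAt
      (fun y => v' y ^ 2 / 8 + Real.exp (v y) + p ^ 2 * Real.exp (-v y) ^ 2 / 2) 0 y := fun y => by
    refine (((((h.hasDerivAt_deriv y).fun_pow 2).div_const 8).add (h.hasDerivAt y).exp).add
      ((((h.hasDerivAt y).fun_neg.exp.fun_pow 2).const_mul (p ^ 2)).div_const 2)).congr_deriv ?_
    push_cast
    ring
  have hconst := is_const_of_deriv_eq_zero (fun y => (henergy y).differentiableAt)
    (fun y => (henergy y).deriv) y 0
  simp only [h.deriv_zero, Real.exp_neg] at hconst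
  field_simp at hconst ⊢
  linear_combination hconst

theorem sq_lt (hne : ∃ y, v y ≠ v 0) : p ^ 2 < Real.exp (v 0) ^ 3 := by
  obtain ⟨y, hy⟩ := hne
  have hlt : Real.exp (v y) < Real.exp (v 0) := Real.exp_lt_exp.2 ((h.le_zero y).lt_of_ne hy)
  have hint := h.first_integral y
  have hw := Real.exp_pos (v y)
  generalize Real.exp (v y) = w at *
  generalize Real.exp (v 0) = a at *
  have ha : 0 < a := hw.trans hlt
  by_contra! hp
  have hpa : a / 2 ≤ p ^ 2 / (2 * a ^ 2) := by
    rw [div_le_div_iff₀ two_pos (by positivity)]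
    linarith
  have hfactor : w ^ 2 - p ^ 2 / (2 * a ^ 2) * (w + a) < 0 := by
    have hmul : a / 2 * (w + a) ≤ p ^ 2 / (2 * a ^ 2) * (w + a) := by gcongr
    nlinarith
  have hneg := mul_pos_of_neg_of_neg (sub_neg.2 hlt) hfactor
  nlinarith [mul_nonneg (sq_nonneg (v' y)) (sq_nonneg w)]

theorem hasDerivAt_exp (y : ℝ) :
    HasDerivAt (fun y => Real.exp (v y)) (Real.exp (v y) * v' y) y := (h.hasDerivAt y).exp

theorem hasDerivAt_exp_deriv {a₁ a₂ a₃ k r : ℝ} (ha₁ : Real.exp (v 0) = a₁)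
    (H : IsProfile a₁ a₂ a₃ p k r) (y : ℝ) :
    HasDerivAt (fun y => Real.exp (v y) * v' y)
      (8 * (a₁ + a₂ - a₃) * Real.exp (v y) - 12 * Real.exp (v y) ^ 2) y := by
  refine ((h.hasDerivAt_exp y).mul (h.hasDerivAt_deriv y)).congr_deriv ?_
  have h₁ := H.pos₁
  have hint := h.first_integral y
  rw [ha₁, H.sq_p, mul_div_cancel_left₀ _ (by positivity)] at hint
  rw [Real.exp_neg]
  field_simp
  linear_combination hint + 4 * H.sq_p

theorem exp_eq {a₁ a₂ a₃ k r : ℝ} (ha₁ : Real.exp (v 0) = a₁) (H : IsProfile a₁ a₂ a₃ p k r)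
    (y : ℝ) : Real.exp (v y) = a₁ - (a₁ - a₂) * jacobiSn (r * y) k ^ 2 := by
  refine sub_eq_zero.1 (eq_zero_of_hasDerivAt_smul
    (q := fun y => 8 * (a₁ + a₂ - a₃) -
      12 * (Real.exp (v y) + (a₁ - (a₁ - a₂) * jacobiSn (r * y) k ^ 2))) ?_
    (fun y => (h.hasDerivAt_exp y).sub (H.hasDerivAt_profile y))
    (fun y => ((h.hasDerivAt_exp_deriv ha₁ H y).sub (H.hasDerivAt_profile_deriv y)).congr_deriv ?_)
    ?_ ?_ y)
  · have hv : Continuous v := continuous_iff_continuousAt.2 fun y => (h.hasDerivAt y).continuousAt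
    have hsn := H.continuous_jacobiSn
    fun_prop
  · simp only [Pi.sub_apply, smul_eq_mul]
    ring
  · simp [jacobiSn_zero H.sq_k_lt_one, ha₁]
  · simp [h.deriv_zero, jacobiSn_zero H.sq_k_lt_one]

end IsGaussSolution

section Line

theorem hasDerivAt_comp_ofReal_add {E : Type*} [NormedAddCommGroup E] [NormedSpace ℝ E]
    {G : ℂ → E} (hG : Differentiable ℝ G) (z : ℂ) (t : ℝ) :
    HasDerivAt (fun t : ℝ => G (t + z)) (fderiv ℝ G (t + z) 1) t :=
  (hG _).hasFDerivAt.comp_hasDerivAt t ((Complex.ofRealCLM.hasDerivAt (x := t)).add_const z)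

theorem hasDerivAt_comp_ofReal_mul_I {E : Type*} [NormedAddCommGroup E] [NormedSpace ℝ E]
    {G : ℂ → E} (hG : Differentiable ℝ G) (y : ℝ) :
    HasDerivAt (fun y : ℝ => G (y * Complex.I)) (fderiv ℝ G (y * Complex.I) Complex.I) y := by
  have hline : HasDerivAt (fun y : ℝ => (y : ℂ) * Complex.I) Complex.I y := by
    simpa using (Complex.ofRealCLM.hasDerivAt (x := y)).mul_const Complex.I
  exact (hG _).hasFDerivAt.comp_hasDerivAt y hline

variable {E : Type*} [NormedAddCommGroup E] [NormedSpace ℂ E] {G : ℂ → E} {c : ℂ}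

theorem exp_smul_eq_of_fderiv_one (hG : Differentiable ℝ G)
    (hc : ∀ z, fderiv ℝ G z 1 = c • G z) (x : ℝ) (z : ℂ) :
    G (x + z) = Complex.exp (c * x) • G z := by
  have hexp : ∀ t : ℝ, HasDerivAt (fun t : ℝ => Complex.exp (-(c * t)))
      (Complex.exp (-(c * t)) * -c) t := fun t => by
    simpa using ((Complex.ofRealCLM.hasDerivAt (x := t)).const_mul c).fun_neg.cexp
  have hderiv : ∀ t : ℝ, HasDerivAt (fun t : ℝ => Complex.exp (-(c * t)) • G (t + z)) 0 t :=
    fun t => ((hexp t).smul (hasDerivAt_comp_ofReal_add hG z t)).congr_deriv <| by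
      rw [hc, smul_smul, ← add_smul]
      ring_nf
      exact zero_smul ℂ _
  have hconst := is_const_of_deriv_eq_zero (fun t => (hderiv t).differentiableAt)
    (fun t => (hderiv t).deriv) x 0
  rw [Complex.ofReal_zero, mul_zero, neg_zero, Complex.exp_zero, one_smul, zero_add,
    Complex.exp_neg] at hconst
  rw [← hconst, smul_inv_smul₀ (Complex.exp_ne_zero _)]

theorem hasDerivAt_fderiv_I_comp_ofReal_mul_I (hG : ContDiff ℝ ∞ G)
    (hc : ∀ z, fderiv ℝ G z 1 = c • G z) (y : ℝ) :
    HasDerivAt (fun y : ℝ => fderiv ℝ G (y * Complex.I) Complex.I)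
      (flatLaplacian G (y * Complex.I) - c ^ 2 • G (y * Complex.I)) y := by
  have hxx : fderiv ℝ (fun w => fderiv ℝ G w 1) (y * Complex.I) 1 = c ^ 2 • G (y * Complex.I) := by
    simp only [hc]
    rw [fderiv_fun_const_smul (hG.differentiable (by simp) _), smul_apply, hc,
      smul_smul, sq]
  rw [flatLaplacian, hxx, add_sub_cancel_left]
  exact hasDerivAt_comp_ofReal_mul_I (fun z => (hasFDerivAt_fderiv_apply hG z _).differentiableAt) y

end Line

section Translation

theorem wirtinger_mulVec (B : Matrix (Fin 3) (Fin 3) ℂ) {F : ℂ → Fin 3 → ℂ}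
    {ε z : ℂ} (hF : DifferentiableAt ℝ F z) :
    wirtinger ε (fun w => B *ᵥ F w) z = B *ᵥ wirtinger ε F z :=
  wirtinger_clm_comp (Matrix.mulVecLin B).toContinuousLinearMap hF

namespace IsHorizontalLift

variable {f : ℂ → CP2} {F G : ℂ → Fin 3 → ℂ}

theorem comp_add_left (hF : IsHorizontalLift f F) (t : ℂ) :
    IsHorizontalLift (fun z => f (t + z)) fun z => F (t + z) where
  smooth := hF.smooth.comp (contDiff_const.add contDiff_id)
  unit _ := hF.unit _
  lift _ := hF.lift _
  horizontal_z z := by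
    rw [dz_eq_wirtinger, wirtinger_comp_add_left, ← dz_eq_wirtinger, hF.horizontal_z]
  horizontal_zbar z := by
    rw [dzbar_eq_wirtinger, wirtinger_comp_add_left, ← dzbar_eq_wirtinger, hF.horizontal_zbar]

theorem mulVec (hF : IsHorizontalLift f F) {R : Matrix.SpecialLinearGroup (Fin 3) ℂ}
    (hR : IsSU3 R) :
    IsHorizontalLift (fun z => R • f z) fun z => (R : Matrix (Fin 3) (Fin 3) ℂ) *ᵥ F z where
  smooth :=
    ((Matrix.mulVecLin R.1).toContinuousLinearMap.restrictScalars ℝ).contDiff.comp hF.smooth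
  unit z := by rw [herm_mulVec_mulVec hR, hF.unit]
  lift z := by
    obtain ⟨h, hfz⟩ := hF.lift z
    exact ⟨_, by rw [← hfz, Projectivization.smul_mk]; rfl⟩
  horizontal_z z := by
    rw [dz_eq_wirtinger, wirtinger_mulVec _ (hF.smooth.differentiable (by simp) z),
      ← dz_eq_wirtinger, herm_mulVec_mulVec hR, hF.horizontal_z]
  horizontal_zbar z := by
    rw [dzbar_eq_wirtinger, wirtinger_mulVec _ (hF.smooth.differentiable (by simp) z),
      ← dzbar_eq_wirtinger, herm_mulVec_mulVec hR, hF.horizontal_zbar]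

theorem eq_herm_smul (hF : IsHorizontalLift f F) (hG : IsHorizontalLift f G) (z : ℂ) :
    F z = herm (F z) (G z) • G z := by
  obtain ⟨h₁, hF₁⟩ := hF.lift z
  obtain ⟨h₂, hG₂⟩ := hG.lift z
  obtain ⟨a, ha⟩ := (Projectivization.mk_eq_mk_iff ℂ _ _ h₁ h₂).1 (hF₁.trans hG₂.symm)
  rw [← ha, Units.smul_def, herm_smul_left, hG.unit, mul_one]

theorem exists_phase (hF : IsHorizontalLift f F) (hG : IsHorizontalLift f G) :
    ∃ c : ℂ, c * star c = 1 ∧ ∀ z, F z = c • G z := by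
  set c : ℂ → ℂ := fun z => herm (F z) (G z)
  have hFG : F = fun z => c z • G z := funext (hF.eq_herm_smul hG)
  have hdG := hG.smooth.differentiable (by simp)
  have hdc : Differentiable ℝ c := (contDiff_herm hF.smooth hG.smooth).differentiable (by simp)
  have hunit : ∀ z, c z * star (c z) = 1 := fun z => by
    rw [← hF.unit z, hF.eq_herm_smul hG z, herm_smul_left, herm_smul_right, hG.unit, mul_one]
  have hne : ∀ z, star (c z) ≠ 0 := fun z => right_ne_zero_of_mul_eq_one (hunit z)
  have hdz : ∀ z, dz c z = 0 := fun z => by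
    have hhor := hF.horizontal_z z
    rw [hFG, dz_smul (hdc z) (hdG z), herm_smul_right, herm_add_left, herm_smul_left,
      herm_smul_left, hG.unit, hG.horizontal_z, mul_one, mul_zero, add_zero] at hhor
    exact (mul_eq_zero.1 hhor).resolve_left (hne z)
  have hdzbar : ∀ z, dzbar c z = 0 := fun z => by
    have hhor := hF.horizontal_zbar z
    rw [hFG, dzbar_smul (hdc z) (hdG z), herm_smul_right, herm_add_left, herm_smul_left,
      herm_smul_left, hG.unit, hG.horizontal_zbar, mul_one, mul_zero, add_zero] at hhor
    exact (mul_eq_zero.1 hhor).resolve_left (hne z)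
  refine ⟨c 0, hunit 0, fun z => ?_⟩
  rw [← eq_of_dz_eq_zero_of_dzbar_eq_zero hdc hdz hdzbar z 0]
  exact hF.eq_herm_smul hG z

theorem herm_dz_self_eq (hF : IsHorizontalLift f F) (hG : IsHorizontalLift f G) (z : ℂ) :
    herm (dz F z) (dz F z) = herm (dz G z) (dz G z) := by
  obtain ⟨c, hc, hFG⟩ := hF.exists_phase hG
  have hdz : dz F z = c • dz G z := by
    rw [funext hFG, dz_smul (differentiableAt_const c) (hG.smooth.differentiable (by simp) z),
      dz_const, zero_smul, zero_add]
  rw [hdz, herm_smul_left, herm_smul_right, ← mul_assoc, hc, one_mul]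

end IsHorizontalLift

theorem IsTranslationallyEquivariant.conformalFactor_add {f : ℂ → CP2} {F : ℂ → Fin 3 → ℂ}
    {u : ℂ → ℝ} {φ : ℂ → ℂ} (hequiv : IsTranslationallyEquivariant f) (hF : IsHorizontalLift f F)
    (h : IsMinimalLegendrian F u φ) (t : ℝ) (z : ℂ) : u (t + z) = u z := by
  obtain ⟨R, hR, -, -, hRf⟩ := hequiv
  have hRF : IsHorizontalLift (fun z => f (t + z))
      fun z => (R t : Matrix (Fin 3) (Fin 3) ℂ) *ᵥ F z :=
    (funext (hRf t)).symm ▸ hF.mulVec (hR t)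
  have hmetric := (hF.comp_add_left t).herm_dz_self_eq hRF z
  simp only [dz_eq_wirtinger, wirtinger_comp_add_left, wirtinger_mulVec _ (h.differentiable z),
    herm_mulVec_mulVec (hR t)] at hmetric
  rw [← dz_eq_wirtinger, h.metric_z, h.metric_z] at hmetric
  exact Real.exp_injective (by exact_mod_cast hmetric)

theorem fderiv_one_eq_zero_of_add {E : Type*} [NormedAddCommGroup E] [NormedSpace ℝ E]
    {G : ℂ → E} (hG : Differentiable ℝ G) (hGt : ∀ (t : ℝ) z, G (t + z) = G z) (z : ℂ) :
    fderiv ℝ G z 1 = 0 := by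
  have hderiv := hasDerivAt_comp_ofReal_add hG z 0
  simp only [hGt, Complex.ofReal_zero, zero_add] at hderiv
  exact hderiv.unique (hasDerivAt_const _ _)

theorem IsMinimalLegendrian.exists_isGaussSolution {F : ℂ → Fin 3 → ℂ} {u : ℂ → ℝ} {φ : ℂ → ℂ}
    (h : IsMinimalLegendrian F u φ) (hut : ∀ (t : ℝ) z, u (t + z) = u z) (hmax : ∀ z, u z ≤ u 0)
    {p : ℝ} (hp : ∀ z, ‖φ z‖ ^ 2 = p ^ 2) :
    ∃ v', IsGaussSolution p (fun y : ℝ => u (y * Complex.I)) v' := by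
  have hu := h.contDiff_ofReal_u
  have hx : ∀ z, fderiv ℝ (fun w => (u w : ℂ)) z 1 = (0 : ℂ) • (u z : ℂ) := fun z => by
    rw [fderiv_one_eq_zero_of_add (hu.differentiable (by simp)) (fun t z => by rw [hut]), zero_smul]
  refine ⟨_, fun y => Complex.reCLM.hasFDerivAt.comp_hasDerivAt y
    (hasDerivAt_comp_ofReal_mul_I (hu.differentiable (by simp)) y), fun y => ?_,
    fun y => by simpa using hmax (y * Complex.I)⟩
  refine (Complex.reCLM.hasFDerivAt.comp_hasDerivAt y
    (hasDerivAt_fderiv_I_comp_ofReal_mul_I hu hx y)).congr_deriv ?_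
  rw [flatLaplacian_eq_four_smul_dzbar_dz hu, h.gauss, hp, sq (0 : ℂ), zero_mul, zero_smul,
    sub_zero, smul_eq_mul, ← Complex.ofReal_ofNat, ← Complex.ofReal_mul]
  exact Complex.ofReal_re _

end Translation

section Frame

theorem frameV_eq_neg_conjTranspose {u : ℂ → ℝ} {z : ℂ} (hu : DifferentiableAt ℝ u z)
    (ψ : ℂ → ℂ) {lam : ℂ} (hlam : ‖lam‖ = 1) :
    frameV u ψ lam z = -(frameU u ψ lam z)ᴴ := by
  have hdz : star (dz (fun w => (u w : ℂ)) z) = dzbar (fun w => (u w : ℂ)) z := by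
    have hu' : DifferentiableAt ℝ (fun w => (u w : ℂ)) z :=
      Complex.ofRealCLM.differentiableAt.comp z hu
    simp [star_dz hu']
  have hinv := star_eq_inv hlam
  simp only [Complex.star_def] at hdz hinv
  ext i j
  fin_cases i <;> fin_cases j <;>
    simp [frameU, frameV, hdz, hinv, -Complex.ofReal_exp] <;> ring

theorem conjTranspose_potentialD (a : ℝ) (p : ℂ) {lam : ℂ} (hlam : ‖lam‖ = 1) :
    (potentialD a p lam)ᴴ = -potentialD a p lam := by
  have hinv := star_eq_inv hlam
  simp only [Complex.star_def] at hinv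
  ext i j
  fin_cases i <;> fin_cases j <;> simp [potentialD, hinv, neg_div]

theorem frameU_add_frameV_of_max {u : ℂ → ℝ} (ψ : ℂ → ℂ) (lam : ℂ) {z : ℂ}
    (hu : DifferentiableAt ℝ u z) (hmax : ∀ w, u w ≤ u z) :
    frameU u ψ lam z + frameV u ψ lam z = potentialD (Real.exp (u z)) (ψ z) lam := by
  have hcrit : fderiv ℝ u z = 0 := IsLocalMax.fderiv_eq_zero (Filter.Eventually.of_forall hmax)
  have hcrit' : fderiv ℝ (fun w => (u w : ℂ)) z = 0 := by
    refine (Complex.ofRealCLM.hasFDerivAt.comp z hu.hasFDerivAt).fderiv.trans ?_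
    rw [hcrit, ContinuousLinearMap.comp_zero]
  have hsqrt : Real.sqrt (Real.exp (u z)) = Real.exp (u z / 2) := (Real.exp_half _).symm
  ext i j
  fin_cases i <;> fin_cases j <;>
    simp [frameU, frameV, potentialD, dz, dzbar, hcrit', hsqrt, -Complex.ofReal_exp,
      Real.exp_neg] <;> ring

theorem frameU_add {u : ℂ → ℝ} {ψ : ℂ → ℂ} {lam t : ℂ} (hut : ∀ z, u (t + z) = u z)
    (hψt : ∀ z, ψ (t + z) = ψ z) (z : ℂ) : frameU u ψ lam (t + z) = frameU u ψ lam z := by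
  simp only [frameU, dz_eq_wirtinger, ← wirtinger_comp_add_left, hut, hψt]

theorem frameV_add {u : ℂ → ℝ} {ψ : ℂ → ℂ} {lam t : ℂ} (hut : ∀ z, u (t + z) = u z)
    (hψt : ∀ z, ψ (t + z) = ψ z) (z : ℂ) : frameV u ψ lam (t + z) = frameV u ψ lam z := by
  simp only [frameV, dzbar_eq_wirtinger, ← wirtinger_comp_add_left, hut, hψt]

theorem eq_zero_of_dz_eq_vecMul {U : ℂ → Matrix (Fin 3) (Fin 3) ℂ} {ρ : ℂ → Fin 3 → ℂ}
    (hρ : ContDiff ℝ ∞ ρ) (hdz : ∀ z, dz ρ z = ρ z ᵥ* U z)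
    (hdzbar : ∀ z, dzbar ρ z = ρ z ᵥ* -(U z)ᴴ) (h0 : ρ 0 = 0) (z : ℂ) : ρ z = 0 := by
  have hd := hρ.differentiable (by simp)
  have hadj : ∀ w (M : Matrix (Fin 3) (Fin 3) ℂ), herm (ρ w) (ρ w ᵥ* -Mᴴ) =
      -herm (ρ w ᵥ* M) (ρ w) := fun w M => by
    rw [herm, Matrix.star_vecMul, Matrix.dotProduct_mulVec, Matrix.conjTranspose_neg,
      Matrix.conjTranspose_conjTranspose, Matrix.vecMul_neg, neg_dotProduct, herm]
  have hnorm := eq_of_dz_eq_zero_of_dzbar_eq_zero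
    ((contDiff_herm hρ hρ).differentiable (by simp))
    (fun w => by rw [dz_herm (hd w) (hd w), hdz, hdzbar, hadj, add_neg_cancel])
    (fun w => by
      rw [dzbar_herm (hd w) (hd w), hdz, hdzbar, ← star_herm, hadj, star_neg, star_herm,
        neg_add_cancel]) z 0
  rw [h0] at hnorm
  exact herm_self_eq_zero.1 (hnorm.trans (herm_self_eq_zero.2 rfl))

end Frame

namespace IsExtendedFrame

variable {u : ℂ → ℝ} {ψ : ℂ → ℂ} {lam : ℂ} {Φ : ℂ → Matrix (Fin 3) (Fin 3) ℂ}
  (h : IsExtendedFrame u ψ lam Φ)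
include h

theorem differentiable (i j : Fin 3) : Differentiable ℝ fun w => Φ w i j :=
  (h.smooth i j).differentiable (by simp)

theorem contDiff_col (j : Fin 3) : ContDiff ℝ ∞ fun w => (Φ w).col j :=
  contDiff_pi.2 fun i => h.smooth i j

theorem differentiable_col (j : Fin 3) : Differentiable ℝ fun w => (Φ w).col j :=
  (h.contDiff_col j).differentiable (by simp)

theorem dz_col (z : ℂ) (j : Fin 3) :
    dz (fun w => (Φ w).col j) z = (Φ z * frameU u ψ lam z).col j := by
  ext i
  rw [dz_eq_wirtinger, wirtinger_apply (h.differentiable_col j z), ← dz_eq_wirtinger]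
  exact h.eq_z z i j

theorem dzbar_col (z : ℂ) (j : Fin 3) :
    dzbar (fun w => (Φ w).col j) z = (Φ z * frameV u ψ lam z).col j := by
  ext i
  rw [dzbar_eq_wirtinger, wirtinger_apply (h.differentiable_col j z), ← dzbar_eq_wirtinger]
  exact h.eq_zbar z i j

theorem dzbar_dz_col_two (hlam : ‖lam‖ = 1) (hu : ContDiff ℝ ∞ u) (z : ℂ) :
    dzbar (dz fun w => (Φ w).col 2) z = (-Real.exp (u z) : ℂ) • (Φ z).col 2 := by
  have hexp : ContDiff ℝ ∞ fun w => (Real.exp (u w / 2) : ℂ) :=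
    Complex.ofRealCLM.contDiff.comp (hu.div_const 2).exp
  have hdexp : DifferentiableAt ℝ (fun w => Complex.I * lam⁻¹ * (Real.exp (u w / 2) : ℂ)) z :=
    (hexp.differentiable (by simp) z).const_mul _
  have hdz : (dz fun w => (Φ w).col 2) =
      fun z => (Complex.I * lam⁻¹ * Real.exp (u z / 2)) • (Φ z).col 0 := by
    funext z
    ext i
    rw [h.dz_col, Matrix.col_apply, mul_frameU_apply]
    rfl
  have hdzbar : dzbar (fun w => (Φ w).col 0) z =
      (-dzbar (fun w => (u w : ℂ)) z / 2) • (Φ z).col 0 +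
        (Complex.I * lam * Real.exp (u z / 2)) • (Φ z).col 2 := by
    ext i
    rw [h.dzbar_col, Matrix.col_apply, mul_frameV_apply]
    rfl
  have hdzbar_exp := dzbar_ofReal_comp (g := fun t => Real.exp (t / 2)) (u := u) (z := z)
    ((hasDerivAt_id _).div_const 2).exp (hu.differentiable (by simp) z)
  obtain ⟨s, -, -, hexp_half, -, hexp_eq, -⟩ := exists_exp_half_eq (u z)
  rw [hdz, dzbar_smul hdexp (h.differentiable_col 0 z), hdzbar,
    dzbar_mul (differentiableAt_const _) (hexp.differentiable (by simp) z), dzbar_const,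
    hdzbar_exp]
  simp only [Complex.ofReal_mul, hexp_half, hexp_eq, Complex.ofReal_div,
    Complex.ofReal_one, Complex.ofReal_ofNat]
  ext i
  simp only [Pi.smul_apply, Pi.add_apply, smul_eq_mul]
  linear_combination (s ^ 2 * (Φ z).col 2 i) * (lam⁻¹ * lam * Complex.I_mul_I -
    inv_mul_cancel₀ (ne_zero_of_norm_eq_one hlam))

theorem ofReal_add_eq_mul (hlam : ‖lam‖ = 1) (hu : Differentiable ℝ u)
    (hut : ∀ (t : ℝ) z, u (t + z) = u z) (hψ : ∀ z, ψ z = ψ 0) (t : ℝ) (z : ℂ) :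
    Φ (t + z) = Φ t * Φ z := by
  have hψt : ∀ z, ψ (t + z) = ψ z := fun z => (hψ _).trans (hψ z).symm
  ext i j
  set ρ : ℂ → Fin 3 → ℂ := fun w j => Φ (t + w) i j + (-Φ t * Φ w) i j
  have hshift : ∀ j, ContDiff ℝ ∞ fun w => Φ (t + w) i j :=
    fun j => (h.smooth i j).comp (contDiff_const.add contDiff_id)
  have hmul : ∀ j, ContDiff ℝ ∞ fun w => (-Φ t * Φ w) i j := fun j => by
    have hsmooth := h.smooth
    simp only [Matrix.mul_apply]
    fun_prop
  have hρ : ContDiff ℝ ∞ ρ := contDiff_pi.2 fun j => (hshift j).add (hmul j)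
  have hwirt : ∀ {ε : ℂ} {M : ℂ → Matrix (Fin 3) (Fin 3) ℂ},
      (∀ z i j, wirtinger ε (fun w => Φ w i j) z = (Φ z * M z) i j) →
      (∀ z, M (t + z) = M z) → ∀ z, wirtinger ε ρ z = ρ z ᵥ* M z := fun hM hMt z => by
    ext j
    rw [wirtinger_apply (hρ.differentiable (by simp) z), wirtinger_add
      ((hshift j).differentiable (by simp) z) ((hmul j).differentiable (by simp) z),
      wirtinger_comp_add_left (fun w => Φ w i j), hM, hMt,
      wirtinger_const_mul_matrix_apply _ fun i j => h.differentiable i j z]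
    simp only [hM]
    rw [← Matrix.mul_apply, ← Matrix.mul_assoc, ← Matrix.add_apply, ← Matrix.add_mul]
    rfl
  have hzero := eq_zero_of_dz_eq_vecMul (U := frameU u ψ lam) hρ
    (by
      rw [dz_eq_wirtinger]
      exact hwirt (by simpa only [dz_eq_wirtinger] using h.eq_z) (frameU_add (hut t) hψt))
    (fun w => by
      rw [← frameV_eq_neg_conjTranspose (hu w) ψ hlam, dzbar_eq_wirtinger]
      exact hwirt (by simpa only [dzbar_eq_wirtinger] using h.eq_zbar) (frameV_add (hut t) hψt) w)
    (by ext j; simp [ρ, h.init]) z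
  have hj : Φ (t + z) i j + (-Φ t * Φ z) i j = 0 := congrFun hzero j
  rwa [Matrix.neg_mul, Matrix.neg_apply, ← sub_eq_add_neg, sub_eq_zero] at hj

theorem fderiv_one_col (hlam : ‖lam‖ = 1) (hu : Differentiable ℝ u)
    (hut : ∀ (t : ℝ) z, u (t + z) = u z) (hψ : ∀ z, ψ z = ψ 0) (hmax : ∀ z, u z ≤ u 0)
    (j : Fin 3) (z : ℂ) : fderiv ℝ (fun w => (Φ w).col j) z 1 =
      potentialD (Real.exp (u 0)) (ψ 0) lam *ᵥ (Φ z).col j := by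
  have hΦ : ∀ i k, HasDerivAt (fun t : ℝ => Φ t i k)
      (potentialD (Real.exp (u 0)) (ψ 0) lam i k) 0 := fun i k => by
    have hderiv := hasDerivAt_comp_ofReal_add (h.differentiable i k) 0 0
    simp only [add_zero, Complex.ofReal_zero] at hderiv
    rwa [fderiv_one_eq_dz_add_dzbar, h.eq_z, h.eq_zbar, ← Matrix.add_apply, ← Matrix.mul_add,
      h.init, one_mul, frameU_add_frameV_of_max ψ lam (hu 0) hmax] at hderiv
  have hcol := hasDerivAt_comp_ofReal_add (h.differentiable_col j) z 0
  simp only [h.ofReal_add_eq_mul hlam hu hut hψ, Complex.ofReal_zero, zero_add] at hcol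
  refine hcol.unique (hasDerivAt_pi.2 fun i => ?_)
  simp only [Matrix.col_apply, Matrix.mul_apply, Matrix.mulVec, dotProduct]
  exact HasDerivAt.fun_sum fun k _ => (hΦ i k).mul_const _

end IsExtendedFrame

section Component

theorem wirtinger_herm_const {ε z : ℂ} {G : ℂ → Fin 3 → ℂ} (hG : DifferentiableAt ℝ G z)
    (l : Fin 3 → ℂ) : wirtinger ε (fun w => herm (G w) l) z = herm (wirtinger ε G z) l := by
  rw [wirtinger_herm hG (differentiableAt_const l), wirtinger_const]
  simp only [herm, star_zero, dotProduct_zero, add_zero]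

variable {G : ℂ → Fin 3 → ℂ} (hG : ContDiff ℝ ∞ G) (l : Fin 3 → ℂ) (z : ℂ)
include hG

theorem fderiv_one_herm_const :
    fderiv ℝ (fun w => herm (G w) l) z 1 = herm (fderiv ℝ G z 1) l := by
  have hd := hG.differentiable (by simp) z
  simp only [fderiv_one_eq_dz_add_dzbar, dz_eq_wirtinger, dzbar_eq_wirtinger,
    wirtinger_herm_const hd, herm_add_left]

theorem fderiv_I_herm_const :
    fderiv ℝ (fun w => herm (G w) l) z Complex.I = herm (fderiv ℝ G z Complex.I) l := by
  have hd := hG.differentiable (by simp) z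
  simp only [fderiv_I_eq_dz_sub_dzbar, dz_eq_wirtinger, dzbar_eq_wirtinger,
    wirtinger_herm_const hd, herm_sub_left, herm_smul_left, smul_eq_mul]

theorem flatLaplacian_herm_const :
    flatLaplacian (fun w => herm (G w) l) z = herm ((4 : ℂ) • dzbar (dz G) z) l := by
  have hdz : dz (fun w => herm (G w) l) = fun w => herm (dz G w) l := funext fun w => by
    simp only [dz_eq_wirtinger, wirtinger_herm_const (hG.differentiable (by simp) w)]
  have hl : ContDiff ℝ ∞ fun w => herm (G w) l := contDiff_herm hG contDiff_const
  rw [flatLaplacian_eq_four_smul_dzbar_dz hl, hdz, dzbar_eq_wirtinger, dzbar_eq_wirtinger,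
    wirtinger_herm_const ((contDiff_dz hG).differentiable (by simp) z), herm_smul_left, smul_eq_mul]

end Component

section Eigenvectors

/-- The eigenvector of `D(λ)` for the eigenvalue `i d₁`, before normalization. -/
noncomputable def antisymmetricVector (lam : ℂ) : Fin 3 → ℂ := ![-lam⁻¹, lam, 0]

/-- The eigenvector of `D(λ)` for the eigenvalue `i d`, before normalization, where
`t = d / (2 √a₁)` and `d` is `d₂` or `d₃`. -/
noncomputable def symmetricVector (lam : ℂ) (t : ℝ) : Fin 3 → ℂ := ![lam⁻¹ * t, lam * t, 1]

variable {lam : ℂ} (hlam : ‖lam‖ = 1)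
include hlam

theorem herm_antisymmetricVector_self :
    herm (antisymmetricVector lam) (antisymmetricVector lam) = 2 := by
  have h0 := ne_zero_of_norm_eq_one hlam
  have hinv : starRingEnd ℂ lam = lam⁻¹ := star_eq_inv hlam
  simp only [herm, antisymmetricVector, dotProduct, Fin.sum_univ_three, Pi.star_apply,
    Complex.star_def, Matrix.cons_val, map_neg, map_inv₀, map_zero, hinv]
  field_simp
  norm_num

theorem herm_antisymmetricVector_symmetricVector (t : ℝ) :
    herm (antisymmetricVector lam) (symmetricVector lam t) = 0 := by
  have h0 := ne_zero_of_norm_eq_one hlam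
  have hinv : starRingEnd ℂ lam = lam⁻¹ := star_eq_inv hlam
  simp [herm, antisymmetricVector, symmetricVector, dotProduct, Fin.sum_univ_three, hinv,
    h0]

theorem herm_symmetricVector_symmetricVector (t t' : ℝ) :
    herm (symmetricVector lam t) (symmetricVector lam t') = (2 * (t * t') + 1 : ℝ) := by
  have h0 := ne_zero_of_norm_eq_one hlam
  have hinv : starRingEnd ℂ lam = lam⁻¹ := star_eq_inv hlam
  simp [herm, symmetricVector, dotProduct, Fin.sum_univ_three, hinv]
  field_simp
  ring

variable {a P : ℝ} (ha : 0 < a)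
include ha

theorem potentialD_mulVec_antisymmetricVector :
    potentialD a (lam ^ 3 * P) lam *ᵥ antisymmetricVector lam =
      (Complex.I * (P / a : ℝ)) • antisymmetricVector lam := by
  have h0 := ne_zero_of_norm_eq_one hlam
  have hinv : starRingEnd ℂ lam = lam⁻¹ := star_eq_inv hlam
  have ha' : (a : ℂ) ≠ 0 := by exact_mod_cast ha.ne'
  ext i
  fin_cases i <;>
    simp [potentialD, antisymmetricVector, Matrix.mulVec, dotProduct, Fin.sum_univ_three,
      hinv] <;> field_simp
  ring

theorem potentialD_mulVec_symmetricVector {d : ℝ} (hd : a * d ^ 2 = 2 * a ^ 2 - P * d) :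
    potentialD a (lam ^ 3 * P) lam *ᵥ symmetricVector lam (d / (2 * Real.sqrt a)) =
      (Complex.I * d) • symmetricVector lam (d / (2 * Real.sqrt a)) := by
  have h0 := ne_zero_of_norm_eq_one hlam
  have hinv : starRingEnd ℂ lam = lam⁻¹ := star_eq_inv hlam
  obtain ⟨b, hb, rfl⟩ : ∃ b, 0 < b ∧ a = b ^ 2 :=
    ⟨Real.sqrt a, Real.sqrt_pos.2 ha, (Real.sq_sqrt ha.le).symm⟩
  have hb' : (b : ℂ) ≠ 0 := by exact_mod_cast hb.ne'
  have hd' : (b ^ 2 * d ^ 2 : ℂ) = 2 * (b ^ 2) ^ 2 - P * d := by exact_mod_cast hd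
  rw [Real.sqrt_sq hb.le]
  ext i
  fin_cases i <;>
    simp [potentialD, symmetricVector, Matrix.mulVec, dotProduct, Fin.sum_univ_three,
      hinv, Real.sqrt_sq hb.le] <;> field_simp
  · linear_combination -hd'
  · linear_combination -hd'
  · ring

end Eigenvectors

namespace IsExtendedFrame

variable {u : ℂ → ℝ} {ψ : ℂ → ℂ} {lam : ℂ} {Φ : ℂ → Matrix (Fin 3) (Fin 3) ℂ}
  (h : IsExtendedFrame u ψ lam Φ)
include h

theorem herm_col_two_zero (l : Fin 3 → ℂ) : herm ((Φ 0).col 2) l = star (l 2) := by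
  simp [h.init, herm, dotProduct, Matrix.one_apply]

theorem fderiv_I_col_two_zero :
    fderiv ℝ (fun w => (Φ w).col 2) 0 Complex.I =
      (Real.exp (u 0 / 2) : ℂ) • antisymmetricVector lam := by
  rw [fderiv_I_eq_dz_sub_dzbar, h.dz_col, h.dzbar_col, h.init, one_mul, one_mul]
  ext i
  fin_cases i <;> simp [frameU, frameV, antisymmetricVector]
  · linear_combination (lam⁻¹ * Complex.exp (u 0 / 2)) * Complex.I_sq
  · linear_combination (-lam * Complex.exp (u 0 / 2)) * Complex.I_sq

variable (hlam : ‖lam‖ = 1) (hu : ContDiff ℝ ∞ u)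
include hlam hu

theorem flatLaplacian_herm_col_two (l : Fin 3 → ℂ) (z : ℂ) :
    flatLaplacian (fun w => herm ((Φ w).col 2) l) z =
      (-4 * Real.exp (u z) : ℝ) • herm ((Φ z).col 2) l := by
  rw [flatLaplacian_herm_const (h.contDiff_col 2), h.dzbar_dz_col_two hlam hu, smul_smul,
    herm_smul_left, Complex.real_smul]
  push_cast
  ring

variable (hut : ∀ (t : ℝ) z, u (t + z) = u z) (hψ : ∀ z, ψ z = ψ 0) (hmax : ∀ z, u z ≤ u 0)
  {l : Fin 3 → ℂ} {d : ℝ} (hl : potentialD (Real.exp (u 0)) (ψ 0) lam *ᵥ l = (Complex.I * d) • l)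
include hut hψ hmax hl

theorem fderiv_one_herm_col (j : Fin 3) (z : ℂ) :
    fderiv ℝ (fun w => herm ((Φ w).col j) l) z 1 = (Complex.I * d) • herm ((Φ z).col j) l := by
  rw [fderiv_one_herm_const (h.contDiff_col j),
    h.fderiv_one_col hlam (hu.differentiable (by simp)) hut hψ hmax, herm_mulVec_left,
    conjTranspose_potentialD _ _ hlam, Matrix.neg_mulVec, hl, ← neg_smul, herm_smul_right]
  simp

theorem herm_col_two_eq {a₁ a₂ a₃ p k r c : ℝ} {j : Fin 3} (H : IsProfile a₁ a₂ a₃ p k r)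
    (hexp : ∀ y : ℝ, Real.exp (u (y * Complex.I)) = a₁ - (a₁ - a₂) * jacobiSn (r * y) k ^ 2)
    (hd : r ^ 2 * lameEigenvalue j k = 4 * a₁ - d ^ 2)
    (h0 : star (l 2) = c * jacobi j 0 k)
    (h1 : Real.exp (u 0 / 2) * herm (antisymmetricVector lam) l = c * (r * jacobiDeriv j 0 k))
    (x y : ℝ) :
    herm ((Φ (x + y * Complex.I)).col 2) l =
      c * jacobi j (r * y) k * Complex.exp (Complex.I * d * x) := by
  have hG : ContDiff ℝ ∞ fun w => herm ((Φ w).col 2) l :=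
    contDiff_herm (h.contDiff_col 2) contDiff_const
  have hx := h.fderiv_one_herm_col hlam hu hut hψ hmax hl 2
  rw [exp_smul_eq_of_fderiv_one (hG.differentiable (by simp)) hx, smul_eq_mul, mul_comm,
    mul_left_inj' (Complex.exp_ne_zero _), ← sub_eq_zero]
  have hq : Continuous fun y => r ^ 2 * (2 * k ^ 2 * jacobiSn (r * y) k ^ 2 - lameEigenvalue j k) :=
    by have := H.continuous_jacobiSn; fun_prop
  refine eq_zero_of_hasDerivAt_smul hq
    (fun y => (hasDerivAt_comp_ofReal_mul_I (hG.differentiable (by simp)) y).sub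
      ((H.hasDerivAt_jacobi j y).ofReal_comp.const_mul (c : ℂ)))
    (fun y => ((hasDerivAt_fderiv_I_comp_ofReal_mul_I hG hx y).sub
      ((H.hasDerivAt_jacobiDeriv j y).ofReal_comp.const_mul (c : ℂ))).congr_deriv ?_) ?_ ?_ y
  · simp only [H.sq_mul_sub_lameEigenvalue_eq hd, ← hexp, h.flatLaplacian_herm_col_two hlam hu,
      Pi.sub_apply, smul_eq_mul, mul_pow, Complex.I_sq, Complex.real_smul]
    push_cast
    ring
  · simp [h.herm_col_two_zero, h0, -Complex.star_def]
  · simp only [Complex.ofReal_zero, zero_mul, fderiv_I_herm_const (h.contDiff_col 2),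
      h.fderiv_I_col_two_zero, herm_smul_left, h1, mul_zero]
    simp

end IsExtendedFrame

namespace IsProfile

/-- The numbers `d₁, d₂, d₃`, such that `i d₁, i d₂, i d₃` are the eigenvalues of `D(λ)`. -/
noncomputable def frequency (a₁ a₂ a₃ P : ℝ) : Fin 3 → ℝ := ![P / a₁, P / a₂, -P / a₃]

/-- The coefficients `c₁, c₂, c₃` of the lift, expressed through `a₁, a₂, a₃` alone. -/
noncomputable def amplitude (a₁ a₂ a₃ : ℝ) : Fin 3 → ℝ :=
  ![Real.sqrt (a₁ / (a₁ + a₃)), Real.sqrt (a₁ / (2 * a₁ - a₃)), Real.sqrt (a₁ / (2 * a₁ + a₂))]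

variable {a₁ a₂ a₃ P k r : ℝ} (H : IsProfile a₁ a₂ a₃ P k r)
include H

theorem a₃_lt : a₃ < a₂ := by
  by_contra! hle
  nlinarith [H.mul_eq, mul_pos H.pos₂ H.pos₃, H.pos₁]

theorem amplitude_zero_eq :
    amplitude a₁ a₂ a₃ 0 = a₁ * Real.sqrt ((a₁ - a₂) / (a₁ ^ 3 - P ^ 2)) := by
  have h₁ := H.pos₁
  have h₃ := H.pos₃
  have hsub : a₁ - a₂ ≠ 0 := (sub_pos.2 H.lt).ne'
  have hfactor : a₁ ^ 3 - P ^ 2 = a₁ * (a₁ - a₂) * (a₁ + a₃) := by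
    linear_combination -H.sq_p + a₁ * H.mul_eq
  have hsq : a₁ / (a₁ + a₃) = a₁ ^ 2 * ((a₁ - a₂) / (a₁ ^ 3 - P ^ 2)) := by
    rw [hfactor]
    field_simp
  rw [← Real.sqrt_sq h₁.le, ← Real.sqrt_mul (sq_nonneg _), Real.sqrt_sq h₁.le, ← hsq]
  rfl

theorem amplitude_one_eq :
    amplitude a₁ a₂ a₃ 1 = a₂ * Real.sqrt ((a₁ - a₂) / (P ^ 2 - a₂ ^ 3)) := by
  have h₁ := H.pos₁
  have h₂ := H.pos₂
  have hsub : 0 < a₁ - a₂ := sub_pos.2 H.lt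
  have hpos : 0 < 2 * a₁ - a₃ := by linarith [H.a₃_lt]
  have hfactor : P ^ 2 - a₂ ^ 3 = a₂ ^ 2 * ((a₁ - a₂) * (2 * a₁ - a₃)) / a₁ := by
    rw [eq_div_iff h₁.ne']
    linear_combination a₁ * H.sq_p + (-2 * a₁ ^ 2 + 2 * a₁ * a₂ - a₂ ^ 2) * H.mul_eq
  have hsq : a₁ / (2 * a₁ - a₃) = a₂ ^ 2 * ((a₁ - a₂) / (P ^ 2 - a₂ ^ 3)) := by
    rw [hfactor]
    field_simp [hpos.ne']
  rw [← Real.sqrt_sq h₂.le, ← Real.sqrt_mul (sq_nonneg _), Real.sqrt_sq h₂.le, ← hsq]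
  rfl

theorem amplitude_two_eq :
    amplitude a₁ a₂ a₃ 2 = a₃ * Real.sqrt ((a₁ + a₃) / (P ^ 2 + a₃ ^ 3)) := by
  have h₁ := H.pos₁
  have h₂ := H.pos₂
  have h₃ := H.pos₃
  have hfactor : P ^ 2 + a₃ ^ 3 = a₃ ^ 2 * ((a₁ + a₃) * (2 * a₁ + a₂)) / a₁ := by
    rw [eq_div_iff h₁.ne']
    linear_combination a₁ * H.sq_p + (-2 * a₁ ^ 2 - 2 * a₁ * a₃ - a₃ ^ 2) * H.mul_eq
  have hsq : a₁ / (2 * a₁ + a₂) = a₃ ^ 2 * ((a₁ + a₃) / (P ^ 2 + a₃ ^ 3)) := by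
    rw [hfactor]
    field_simp
  rw [← Real.sqrt_sq h₃.le, ← Real.sqrt_mul (sq_nonneg _), Real.sqrt_sq h₃.le, ← hsq]
  rfl

theorem frequency_zero_sq : frequency a₁ a₂ a₃ P 0 ^ 2 = 2 * (a₂ - a₃) := by
  have h₁ := H.pos₁
  change (P / a₁) ^ 2 = _
  field_simp
  linear_combination H.sq_p

theorem frequency_one_sq : frequency a₁ a₂ a₃ P 1 ^ 2 = 2 * (a₁ - a₃) := by
  have h₂ := H.pos₂
  change (P / a₂) ^ 2 = _
  field_simp
  linear_combination H.sq_p + (2 * a₂ - 2 * a₁) * H.mul_eq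

theorem frequency_two_sq : frequency a₁ a₂ a₃ P 2 ^ 2 = 2 * (a₁ + a₂) := by
  have h₃ := H.pos₃
  change (-P / a₃) ^ 2 = _
  field_simp
  linear_combination H.sq_p + (-2 * a₃ - 2 * a₁) * H.mul_eq

theorem sq_mul_lameEigenvalue (j : Fin 3) :
    r ^ 2 * lameEigenvalue j k = 4 * a₁ - frequency a₁ a₂ a₃ P j ^ 2 := by
  fin_cases j
  · change r ^ 2 * (1 + k ^ 2) = 4 * a₁ - frequency a₁ a₂ a₃ P 0 ^ 2
    linear_combination H.frequency_zero_sq + (1 + k ^ 2) * H.sq_r + 2 * H.sq_k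
  · change r ^ 2 * 1 = 4 * a₁ - frequency a₁ a₂ a₃ P 1 ^ 2
    linear_combination H.frequency_one_sq + H.sq_r
  · change r ^ 2 * k ^ 2 = 4 * a₁ - frequency a₁ a₂ a₃ P 2 ^ 2
    linear_combination H.frequency_two_sq + k ^ 2 * H.sq_r + 2 * H.sq_k

theorem mul_frequency_one_sq :
    a₁ * frequency a₁ a₂ a₃ P 1 ^ 2 = 2 * a₁ ^ 2 - P * frequency a₁ a₂ a₃ P 1 := by
  have h₂ := H.pos₂
  have hmul : P * frequency a₁ a₂ a₃ P 1 = 2 * a₁ * a₃ := by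
    change P * (P / a₂) = _
    field_simp
    linear_combination H.sq_p - 2 * a₁ * H.mul_eq
  linear_combination a₁ * H.frequency_one_sq + hmul

theorem mul_frequency_two_sq :
    a₁ * frequency a₁ a₂ a₃ P 2 ^ 2 = 2 * a₁ ^ 2 - P * frequency a₁ a₂ a₃ P 2 := by
  have h₃ := H.pos₃
  have hmul : P * frequency a₁ a₂ a₃ P 2 = -2 * a₁ * a₂ := by
    change P * (-P / a₃) = _
    field_simp
    linear_combination -H.sq_p + 2 * a₁ * H.mul_eq
  linear_combination a₁ * H.frequency_two_sq + hmul

theorem frequency_one_mul_frequency_two :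
    frequency a₁ a₂ a₃ P 1 * frequency a₁ a₂ a₃ P 2 = -2 * a₁ := by
  have h₂ := H.pos₂
  have h₃ := H.pos₃
  change P / a₂ * (-P / a₃) = _
  field_simp
  linear_combination -H.sq_p + 2 * a₁ * H.mul_eq

theorem sum_frequency :
    frequency a₁ a₂ a₃ P 0 + frequency a₁ a₂ a₃ P 1 + frequency a₁ a₂ a₃ P 2 = 0 := by
  have h₁ := H.pos₁
  have h₂ := H.pos₂
  have h₃ := H.pos₃
  change P / a₁ + P / a₂ + -P / a₃ = 0
  field_simp
  linear_combination P * H.mul_eq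

theorem amplitude_pos (j : Fin 3) : 0 < amplitude a₁ a₂ a₃ j := by
  have h₁ := H.pos₁
  have h₂ := H.pos₂
  have h₃ := H.pos₃
  have hpos : 0 < 2 * a₁ - a₃ := by linarith [H.a₃_lt, H.lt]
  fin_cases j <;> exact Real.sqrt_pos.2 (by positivity)

theorem amplitude_zero_mul : amplitude a₁ a₂ a₃ 0 * r = Real.sqrt (2 * a₁) := by
  have h₁ := H.pos₁
  have h₃ := H.pos₃
  change Real.sqrt (a₁ / (a₁ + a₃)) * r = _
  rw [← Real.sqrt_sq H.pos_r.le, H.sq_r, ← Real.sqrt_mul (by positivity)]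
  congr 1
  field_simp

theorem amplitude_one_sq_mul : amplitude a₁ a₂ a₃ 1 ^ 2 *
    (2 * (frequency a₁ a₂ a₃ P 1 / (2 * Real.sqrt a₁)) ^ 2 + 1) = 1 := by
  have h₁ := H.pos₁
  have hpos : 0 < 2 * a₁ - a₃ := by linarith [H.a₃_lt, H.lt]
  change Real.sqrt (a₁ / (2 * a₁ - a₃)) ^ 2 * _ = 1
  rw [div_pow, mul_pow, Real.sq_sqrt h₁.le, H.frequency_one_sq, Real.sq_sqrt (by positivity),
    div_mul_eq_mul_div, div_eq_iff hpos.ne']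
  field_simp
  ring

theorem amplitude_two_sq_mul : amplitude a₁ a₂ a₃ 2 ^ 2 *
    (2 * (frequency a₁ a₂ a₃ P 2 / (2 * Real.sqrt a₁)) ^ 2 + 1) = 1 := by
  have h₁ := H.pos₁
  have h₂ := H.pos₂
  change Real.sqrt (a₁ / (2 * a₁ + a₂)) ^ 2 * _ = 1
  rw [div_pow, mul_pow, Real.sq_sqrt h₁.le, H.frequency_two_sq, Real.sq_sqrt (by positivity)]
  field_simp
  ring

/-- The orthonormal basis `l₁, l₂, l₃` of eigenvectors of `D(λ)`, for `ψ = λ³ P`. -/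
noncomputable def eigenbasis (a₁ a₂ a₃ P : ℝ) (lam : ℂ) : Fin 3 → Fin 3 → ℂ :=
  let t (j : Fin 3) : ℝ := frequency a₁ a₂ a₃ P j / (2 * Real.sqrt a₁)
  ![(Real.sqrt 2 : ℂ)⁻¹ • antisymmetricVector lam,
    (amplitude a₁ a₂ a₃ 1 : ℂ) • symmetricVector lam (t 1),
    (amplitude a₁ a₂ a₃ 2 : ℂ) • symmetricVector lam (t 2)]

theorem star_eigenbasis_apply_two (lam : ℂ) (j : Fin 3) :
    star (eigenbasis a₁ a₂ a₃ P lam j 2) = amplitude a₁ a₂ a₃ j * jacobi j 0 k := by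
  rw [jacobi_zero H.sq_k_lt_one]
  fin_cases j <;> simp [eigenbasis, antisymmetricVector, symmetricVector]

variable {lam : ℂ} (hlam : ‖lam‖ = 1)
include hlam

theorem isHermOrthogonal_eigenbasis : IsHermOrthogonal (eigenbasis a₁ a₂ a₃ P lam) 1 := by
  have hanti := herm_antisymmetricVector_symmetricVector hlam
  have hsym := herm_symmetricVector_symmetricVector hlam
  have horth : 2 * (frequency a₁ a₂ a₃ P 1 / (2 * Real.sqrt a₁) *
      (frequency a₁ a₂ a₃ P 2 / (2 * Real.sqrt a₁))) + 1 = 0 := by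
    have h₁ := H.pos₁
    rw [div_mul_div_comm, H.frequency_one_mul_frequency_two, mul_mul_mul_comm,
      Real.mul_self_sqrt h₁.le]
    field_simp
    norm_num
  have hsqrt : (Real.sqrt 2 : ℂ)⁻¹ * ((Real.sqrt 2 : ℂ)⁻¹ * 2) = 1 := by
    norm_cast
    rw [← mul_assoc, ← mul_inv, Real.mul_self_sqrt zero_le_two, inv_mul_cancel₀ two_ne_zero]
  have h1 := H.amplitude_one_sq_mul
  have h2 := H.amplitude_two_sq_mul
  rw [sq, mul_assoc, sq] at h1 h2
  have hvec : IsHermOrthogonal (eigenbasis a₁ a₂ a₃ P lam) _ := isHermOrthogonal_vec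
    (by simp only [herm_smul_left, herm_smul_right, hanti, mul_zero])
    (by simp only [herm_smul_left, herm_smul_right, hanti, mul_zero])
    (by simp only [herm_smul_left, herm_smul_right, hsym, horth, Complex.ofReal_zero, mul_zero])
  simp only [herm_smul_left, herm_smul_right, herm_antisymmetricVector_self hlam, hsym,
    Complex.star_def, map_inv₀, Complex.conj_ofReal, ← Complex.ofReal_mul, h1, h2, hsqrt,
    Complex.ofReal_one] at hvec
  intro i j
  refine (hvec i j).trans (congrArg (if i = j then · else 0) ?_)
  fin_cases i <;> rfl

theorem potentialD_mulVec_eigenbasis (j : Fin 3) :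
    potentialD a₁ (lam ^ 3 * P) lam *ᵥ eigenbasis a₁ a₂ a₃ P lam j =
      (Complex.I * frequency a₁ a₂ a₃ P j) • eigenbasis a₁ a₂ a₃ P lam j := by
  have h₁ := H.pos₁
  fin_cases j <;> simp only [eigenbasis, Fin.zero_eta, Fin.mk_one, Fin.reduceFinMk, Matrix.cons_val,
    Matrix.mulVec_smul, smul_comm _ (amplitude _ _ _ _ : ℂ), smul_comm _ (Real.sqrt 2 : ℂ)⁻¹]
  · rw [potentialD_mulVec_antisymmetricVector hlam h₁]; rfl
  · rw [potentialD_mulVec_symmetricVector hlam h₁ H.mul_frequency_one_sq]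
  · rw [potentialD_mulVec_symmetricVector hlam h₁ H.mul_frequency_two_sq]

theorem herm_antisymmetricVector_eigenbasis (j : Fin 3) :
    Real.sqrt a₁ * herm (antisymmetricVector lam) (eigenbasis a₁ a₂ a₃ P lam j) =
      amplitude a₁ a₂ a₃ j * (r * jacobiDeriv j 0 k) := by
  have hanti := herm_antisymmetricVector_symmetricVector hlam
  rw [jacobiDeriv_zero H.sq_k_lt_one]
  fin_cases j
  · have hsqrt : (Real.sqrt a₁ * ((Real.sqrt 2 : ℂ)⁻¹ * 2) : ℂ) = Real.sqrt (2 * a₁) := by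
      norm_cast
      rw [Real.sqrt_mul zero_le_two]
      field_simp
      norm_num
    simpa [eigenbasis, herm_smul_right, herm_antisymmetricVector_self hlam,
      ← Complex.ofReal_mul, H.amplitude_zero_mul] using hsqrt
  · simp [eigenbasis, herm_smul_right, hanti, -Complex.coe_smul]
  · simp [eigenbasis, herm_smul_right, hanti, -Complex.coe_smul]

end IsProfile

/-- The explicit form of a map `F` on `ℂ`: in an orthonormal basis `l` of eigenvectors of `D` with
eigenvalues `i d₁, i d₂, i d₃`, its components are the Jacobi functions `sn, cn, dn` in `r y`, with
coefficients `c₁, c₂, c₃` and phases `d₁ x, d₂ x, d₃ x`. -/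
structure IsJacobiForm (D : Matrix (Fin 3) (Fin 3) ℂ) (c d : Fin 3 → ℝ) (k r : ℝ)
    (F : ℂ → Fin 3 → ℂ) (l : Fin 3 → Fin 3 → ℂ) : Prop where
  isHermOrthogonal : IsHermOrthogonal l 1
  mulVec_eq : ∀ j, D *ᵥ l j = (Complex.I * d j) • l j
  expansion : ∀ x y : ℝ, F (x + y * Complex.I) =
    ∑ j, (c j * jacobi j (r * y) k * Complex.exp (Complex.I * d j * x)) • l j

open IsProfile in
theorem IsExtendedFrame.isJacobiForm_col_two {u : ℂ → ℝ} {ψ : ℂ → ℂ} {lam : ℂ}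
    {Φ : ℂ → Matrix (Fin 3) (Fin 3) ℂ} (h : IsExtendedFrame u ψ lam Φ) (hlam : ‖lam‖ = 1)
    (hu : ContDiff ℝ ∞ u) (hut : ∀ (t : ℝ) z, u (t + z) = u z) (hmax : ∀ z, u z ≤ u 0)
    {a₁ a₂ a₃ P k r : ℝ} (H : IsProfile a₁ a₂ a₃ P k r) (ha₁ : a₁ = Real.exp (u 0))
    (hψ : ∀ z, ψ z = lam ^ 3 * P)
    (hexp : ∀ y : ℝ, Real.exp (u (y * Complex.I)) = a₁ - (a₁ - a₂) * jacobiSn (r * y) k ^ 2) :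
    IsJacobiForm (potentialD a₁ (ψ 0) lam) (amplitude a₁ a₂ a₃) (frequency a₁ a₂ a₃ P) k r
      (fun z => (Φ z).col 2) (eigenbasis a₁ a₂ a₃ P lam) where
  isHermOrthogonal := H.isHermOrthogonal_eigenbasis hlam
  mulVec_eq := hψ 0 ▸ H.potentialD_mulVec_eigenbasis hlam
  expansion x y := by
    have horth := H.isHermOrthogonal_eigenbasis hlam
    have hsqrt : Real.exp (u 0 / 2) = Real.sqrt a₁ := by rw [ha₁, Real.exp_half]
    refine (horth.sum_herm_smul _).symm.trans (Finset.sum_congr rfl fun j _ => ?_)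
    rw [h.herm_col_two_eq hlam hu hut (fun z => (hψ z).trans (hψ 0).symm) hmax
      (ha₁ ▸ hψ 0 ▸ H.potentialD_mulVec_eigenbasis hlam j) H hexp (H.sq_mul_lameEigenvalue j)
      (H.star_eigenbasis_apply_two lam j) (hsqrt ▸ H.herm_antisymmetricVector_eigenbasis hlam j)]

namespace IsMinimalLegendrian

variable {F : ℂ → Fin 3 → ℂ} {u : ℂ → ℝ}

theorem eq_pow_mul_re {ψ : ℂ → ℂ} {lam : ℂ} (hlam : lam ≠ 0)
    (h : IsMinimalLegendrian F u fun z => -Complex.I * (lam ^ (-3 : ℤ) * ψ z))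
    (hreal : ∀ z, (lam ^ (-3 : ℤ) * ψ z).im = 0) (z : ℂ) :
    ψ z = lam ^ 3 * (lam ^ (-3 : ℤ) * ψ 0).re := by
  have hconst := mul_left_cancel₀ (neg_ne_zero.2 Complex.I_ne_zero) <|
    h.eq_of_im_mul_cubicForm_eq_zero Complex.I_ne_zero (fun w => by
      rw [← mul_assoc, mul_neg, Complex.I_mul_I, neg_neg, one_mul, hreal]) z 0
  have hre : ((lam ^ (-3 : ℤ) * ψ 0).re : ℂ) = lam ^ (-3 : ℤ) * ψ 0 :=
    Complex.ext rfl (hreal 0).symm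
  have hpow : lam ^ (-3 : ℤ) = (lam ^ 3)⁻¹ := by rw [zpow_neg, zpow_ofNat]
  rw [hre, ← hconst, hpow, mul_inv_cancel_left₀ (pow_ne_zero 3 hlam)]

variable {φ : ℂ → ℂ} (h : IsMinimalLegendrian F u φ) (hut : ∀ (t : ℝ) z, u (t + z) = u z)
  (hmax : ∀ z, u z ≤ u 0) {p : ℝ} (hp : ∀ z, ‖φ z‖ ^ 2 = p ^ 2)
include h hut hmax hp

theorem sq_lt_exp_pow_three (hflat : ∃ z, u z ≠ u 0) : p ^ 2 < Real.exp (u 0) ^ 3 := by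
  obtain ⟨v', hv⟩ := h.exists_isGaussSolution hut hmax hp
  obtain ⟨z, hz⟩ := hflat
  have hz' : u (z.im * Complex.I) ≠ u 0 := by rwa [← hut z.re, Complex.re_add_im]
  simpa only [Complex.ofReal_zero, zero_mul] using
    hv.sq_lt ⟨z.im, by simpa only [Complex.ofReal_zero, zero_mul] using hz'⟩

theorem exp_eq_profile {a₁ a₂ a₃ k r : ℝ} (H : IsProfile a₁ a₂ a₃ p k r)
    (ha₁ : a₁ = Real.exp (u 0)) (y : ℝ) :
    Real.exp (u (y * Complex.I)) = a₁ - (a₁ - a₂) * jacobiSn (r * y) k ^ 2 := by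
  obtain ⟨v', hv⟩ := h.exists_isGaussSolution hut hmax hp
  exact hv.exp_eq (by rw [ha₁, Complex.ofReal_zero, zero_mul]) H y

end IsMinimalLegendrian

theorem IsCanonicalLift.isJacobiForm {f : ℂ → CP2} {F₀ F : ℂ → Fin 3 → ℂ} {u : ℂ → ℝ}
    {ψ : ℂ → ℂ} {lam : ℂ} (hF : IsCanonicalLift f u ψ lam F) (hlam : ‖lam‖ = 1)
    (h : IsMinimalLegendrian F₀ u fun z => -Complex.I * (lam ^ (-3 : ℤ) * ψ z))
    (hut : ∀ (t : ℝ) z, u (t + z) = u z) (hmax : ∀ z, u z ≤ u 0) {a₁ a₂ a₃ P k r : ℝ}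
    (H : IsProfile a₁ a₂ a₃ P k r) (ha₁ : a₁ = Real.exp (u 0)) (hψ : ∀ z, ψ z = lam ^ 3 * P) :
    IsJacobiForm (potentialD a₁ (ψ 0) lam) (IsProfile.amplitude a₁ a₂ a₃)
      (IsProfile.frequency a₁ a₂ a₃ P) k r F (IsProfile.eigenbasis a₁ a₂ a₃ P lam) := by
  obtain ⟨⟨Φ, hΦ, hFΦ⟩, -⟩ := hF
  obtain rfl : F = fun z => (Φ z).col 2 := funext fun z => funext (hFΦ z)
  exact hΦ.isJacobiForm_col_two hlam h.contDiff_u hut hmax H ha₁ hψ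
    (h.exp_eq_profile hut hmax (by simp [hψ, hlam]) H ha₁)

section Periods

/-- The group of translations of `ℂ` that leave `f` unchanged. -/
def periodSubgroup (f : ℂ → CP2) : AddSubgroup ℂ where
  carrier := {l | ∀ z, f (z + l) = f z}
  zero_mem' z := by rw [add_zero]
  add_mem' {a b} ha hb z := by rw [← add_assoc, hb, ha]
  neg_mem' {a} ha z := by rw [← ha (z + -a), neg_add_cancel_right]

variable {f : ℂ → CP2}

theorem descendsTo_of_le_periodSubgroup {L : AddSubgroup ℂ} (hL : L ≤ periodSubgroup f) :
    DescendsTo f L := by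
  refine ⟨Quotient.lift f fun a b hab => ?_, fun _ => rfl⟩
  rw [← hL (QuotientAddGroup.leftRel_apply.1 hab) a, add_neg_cancel_left]

theorem mem_periodSubgroup_iff {l : ℂ} :
    l ∈ periodSubgroup f ↔ ∀ x y : ℝ, f (x + y * Complex.I + l) = f (x + y * Complex.I) :=
  ⟨fun hl _ _ => hl _, fun hl z => Complex.re_add_im z ▸ hl z.re z.im⟩

theorem ofReal_mem_periodSubgroup_iff {τ : ℝ} : (τ : ℂ) ∈ periodSubgroup f ↔
    ∀ x y : ℝ, f ((x + τ : ℝ) + y * Complex.I) = f (x + y * Complex.I) := by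
  simp only [mem_periodSubgroup_iff, Complex.ofReal_add, add_right_comm]

theorem linearIndependent_mul_I_ofReal {s t : ℝ} (hs : s ≠ 0) (ht : t ≠ 0) :
    LinearIndependent ℝ ![(s * Complex.I : ℂ), (t : ℂ)] := by
  refine LinearIndependent.pair_iff.2 fun a b hab => ?_
  have hre := congrArg Complex.re hab
  have him := congrArg Complex.im hab
  simp only [Complex.add_re, Complex.add_im, Complex.real_smul, Complex.re_ofReal_mul,
    Complex.im_ofReal_mul, Complex.I_re, Complex.I_im, Complex.ofReal_re, Complex.ofReal_im,
    Complex.zero_re, Complex.zero_im, mul_zero, mul_one, zero_add, add_zero] at hre him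
  exact ⟨(mul_eq_zero.1 him).resolve_right hs, (mul_eq_zero.1 hre).resolve_right ht⟩

theorem exp_I_mul_eq_exp_I_mul_iff (a b τ : ℝ) :
    Complex.exp (Complex.I * a * τ) = Complex.exp (Complex.I * b * τ) ↔
      ∃ n : ℤ, (a - b) * τ = n * (2 * Real.pi) := by
  rw [Complex.exp_eq_exp_iff_exists_int]
  refine exists_congr fun n => ?_
  rw [← Complex.ofReal_inj]
  push_cast
  exact ⟨fun h => mul_left_cancel₀ Complex.I_ne_zero (by linear_combination h),
    fun h => by linear_combination Complex.I * h⟩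

theorem exists_rat_div_eq_of_forall_exp_I_mul_eq {d : Fin 3 → ℝ} (hsum : d 0 + d 1 + d 2 = 0)
    {τ : ℝ} (hτ : τ ≠ 0)
    (hexp : ∀ i j, Complex.exp (Complex.I * d i * τ) = Complex.exp (Complex.I * d j * τ)) :
    ∃ q : ℚ, d 0 / d 1 = q := by
  obtain ⟨m, hm⟩ := (exp_I_mul_eq_exp_I_mul_iff _ _ _).1 (hexp 0 1)
  obtain ⟨n, hn⟩ := (exp_I_mul_eq_exp_I_mul_iff _ _ _).1 (hexp 1 2)
  have h₀ : 3 * τ * d 0 = 2 * Real.pi * (n + 2 * m) := by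
    linear_combination hn + 2 * hm + τ * hsum
  have h₁ : 3 * τ * d 1 = 2 * Real.pi * (n - m) := by
    linear_combination hn - hm + τ * hsum
  refine ⟨(n + 2 * m) / (n - m), ?_⟩
  push_cast
  rw [← mul_div_mul_left (d 0) (d 1) (c := 3 * τ) (by positivity), h₀, h₁,
    mul_div_mul_left _ _ (by positivity)]

theorem forall_exp_I_mul_eq_of_div_eq_rat {d : Fin 3 → ℝ} (hsum : d 0 + d 1 + d 2 = 0)
    (hd : d 1 ≠ 0) {q : ℚ} (hq : d 0 / d 1 = q) (i j : Fin 3) :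
    Complex.exp (Complex.I * d i * (2 * Real.pi * q.den / d 1 : ℝ)) =
      Complex.exp (Complex.I * d j * (2 * Real.pi * q.den / d 1 : ℝ)) := by
  have hratio : d 0 * q.den = q.num * d 1 := by
    rw [← div_eq_div_iff hd (by exact_mod_cast q.den_ne_zero), hq]
    exact_mod_cast (Rat.num_div_den q).symm
  have h₀₁ : ∃ n : ℤ, (d 0 - d 1) * (2 * Real.pi * q.den / d 1) = n * (2 * Real.pi) := by
    refine ⟨q.num - q.den, ?_⟩
    push_cast
    field_simp
    linear_combination hratio
  have h₁₂ : ∃ n : ℤ, (d 1 - d 2) * (2 * Real.pi * q.den / d 1) = n * (2 * Real.pi) := by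
    refine ⟨q.num + 2 * q.den, ?_⟩
    push_cast
    field_simp
    linear_combination hratio - q.den * hsum
  rw [← exp_I_mul_eq_exp_I_mul_iff] at h₀₁ h₁₂
  fin_cases i <;> fin_cases j <;> simp_all

theorem exists_forall_exp_I_mul_eq_iff {d : Fin 3 → ℝ} (hsum : d 0 + d 1 + d 2 = 0)
    (hd : d 1 ≠ 0) :
    (∃ τ : ℝ, τ ≠ 0 ∧ ∀ i j, Complex.exp (Complex.I * d i * τ) = Complex.exp (Complex.I * d j * τ))
      ↔ ∃ q : ℚ, d 0 / d 1 = q := by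
  constructor
  · rintro ⟨τ, hτ, hexp⟩
    exact exists_rat_div_eq_of_forall_exp_I_mul_eq hsum hτ hexp
  · rintro ⟨q, hq⟩
    exact ⟨2 * Real.pi * q.den / d 1, by positivity, forall_exp_I_mul_eq_of_div_eq_rat hsum hd hq⟩

end Periods

namespace IsJacobiForm

variable {D : Matrix (Fin 3) (Fin 3) ℂ} {c d : Fin 3 → ℝ} {k r : ℝ} {F : ℂ → Fin 3 → ℂ}
  {l : Fin 3 → Fin 3 → ℂ} (h : IsJacobiForm D c d k r F l)
include h

theorem apply_add_four_mul (hk : k ^ 2 < 1) {T : ℝ} (hT : r * T = ellipticK k) (x y : ℝ) :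
    F (x + (y + 4 * T : ℝ) * Complex.I) = F (x + y * Complex.I) := by
  have hperiod : r * (y + 4 * T) = r * y + 4 * ellipticK k := by linear_combination 4 * hT
  simp only [h.expansion, hperiod, jacobi_add_four_mul_ellipticK hk]

theorem herm_apply (x y : ℝ) (j : Fin 3) : herm (F (x + y * Complex.I)) (l j) =
    c j * jacobi j (r * y) k * Complex.exp (Complex.I * d j * x) := by
  rw [h.expansion, h.isHermOrthogonal.herm_sum_smul, Pi.one_apply, mul_one]

theorem forall_exists_smul_iff (hk : k ^ 2 < 1) (hr : r ≠ 0) (hc : ∀ j, c j ≠ 0) (τ : ℝ) :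
    (∀ x y : ℝ, ∃ μ : ℂ, F ((x + τ : ℝ) + y * Complex.I) = μ • F (x + y * Complex.I)) ↔
      ∀ i j, Complex.exp (Complex.I * d i * τ) = Complex.exp (Complex.I * d j * τ) := by
  constructor
  · intro hμ
    obtain ⟨x₀, hx₀⟩ := exists_forall_jacobi_ne_zero hk
    obtain ⟨μ, hμ⟩ := hμ 0 (x₀ / r)
    suffices ∀ j, Complex.exp (Complex.I * d j * τ) = μ from fun i j => (this i).trans (this j).symm
    intro j
    have hcoord := congrArg (herm · (l j)) hμ
    beta_reduce at hcoord
    rw [herm_smul_left, h.herm_apply, h.herm_apply, mul_div_cancel₀ _ hr, zero_add,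
      Complex.ofReal_zero, mul_zero, Complex.exp_zero, mul_one] at hcoord
    have hne : (c j * jacobi j x₀ k : ℂ) ≠ 0 := by exact_mod_cast mul_ne_zero (hc j) (hx₀ j)
    exact mul_left_cancel₀ hne (hcoord.trans (mul_comm _ _))
  · intro hexp x y
    refine ⟨Complex.exp (Complex.I * d 0 * τ), ?_⟩
    rw [h.expansion, h.expansion, Finset.smul_sum]
    refine Finset.sum_congr rfl fun j _ => ?_
    rw [smul_smul, Complex.ofReal_add, mul_add, Complex.exp_add, hexp j 0]
    ring_nf

end IsJacobiForm

namespace IsCanonicalLift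

variable {f : ℂ → CP2} {u : ℂ → ℝ} {ψ : ℂ → ℂ} {lam : ℂ} {F : ℂ → Fin 3 → ℂ}
  (hF : IsCanonicalLift f u ψ lam F)
include hF

theorem apply_eq_apply_iff (z w : ℂ) : f z = f w ↔ ∃ μ : ℂ, F z = μ • F w := by
  obtain ⟨-, A, -, hA⟩ := hF
  obtain ⟨hz, hfz⟩ := hA z
  obtain ⟨hw, hfw⟩ := hA w
  rw [hfz, hfw, smul_left_cancel_iff, Projectivization.mk_eq_mk_iff']
  simp only [eq_comm]

variable {D : Matrix (Fin 3) (Fin 3) ℂ} {c d : Fin 3 → ℝ} {k r : ℝ} {l : Fin 3 → Fin 3 → ℂ}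
  (h : IsJacobiForm D c d k r F l) (hk : k ^ 2 < 1)
include h hk

theorem mul_I_mem_periodSubgroup {T : ℝ} (hT : r * T = ellipticK k) :
    (4 * T * Complex.I : ℂ) ∈ periodSubgroup f := by
  refine mem_periodSubgroup_iff.2 fun x y => (hF.apply_eq_apply_iff _ _).2 ⟨1, ?_⟩
  rw [one_smul, ← h.apply_add_four_mul hk hT x y]
  push_cast
  ring_nf

theorem ofReal_mem_periodSubgroup_iff_forall_exp_eq (hr : r ≠ 0) (hc : ∀ j, c j ≠ 0) (τ : ℝ) :
    (τ : ℂ) ∈ periodSubgroup f ↔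
      ∀ i j, Complex.exp (Complex.I * d i * τ) = Complex.exp (Complex.I * d j * τ) := by
  rw [ofReal_mem_periodSubgroup_iff, ← h.forall_exists_smul_iff hk hr hc]
  simp only [hF.apply_eq_apply_iff]

end IsCanonicalLift

end MinLag

theorem mainTheorem7
    -- the surface, its metric `2 e^u dz dz̄`, and its Hopf differential `-i λ⁻³ ψ dz³`
    (f : ℂ → MinLag.CP2) (u : ℂ → ℝ) (ψ : ℂ → ℂ) (lam : ℂ) (hlam : ‖lam‖ = 1)
    (hf : MinLag.IsConformalMinimalLagrangian f u
      (fun z => -Complex.I * (lam ^ (-3 : ℤ) * ψ z)))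
    (hequiv : MinLag.IsTranslationallyEquivariant f)
    -- not totally geodesic, not flat, the origin is a maximum of the metric
    (hψ : ∃ z, ψ z ≠ 0)
    (hflat : ∃ z, u z ≠ u 0)
    (hmax : ∀ z, u z ≤ u 0)
    -- the cubic form is real
    (hreal : ∀ z, (lam ^ (-3 : ℤ) * ψ z).im = 0)
    -- the constants
    (a₁ a₂ a₃ β k r T P d₁ d₂ d₃ c₁ c₂ c₃ : ℝ)
    (ha₁ : a₁ = Real.exp (u 0))
    (hβ : β = 2 * a₁ + ‖ψ 0‖ ^ 2 / a₁ ^ 2)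
    (ha₂ : a₂ = (β / 2 - a₁ + Real.sqrt ((β / 2 - a₁) ^ 2 + 4 * a₁ * (β / 2 - a₁))) / 2)
    (ha₃ : a₃ = (-(β / 2 - a₁) + Real.sqrt ((β / 2 - a₁) ^ 2 + 4 * a₁ * (β / 2 - a₁))) / 2)
    (hk : k = Real.sqrt ((a₁ - a₂) / (a₁ + a₃)))
    (hr : r = Real.sqrt (2 * (a₁ + a₃)))
    (hT : T = MinLag.ellipticK k / r)
    (hP : P = (lam ^ (-3 : ℤ) * ψ 0).re)
    (hd₁ : d₁ = P / a₁) (hd₂ : d₂ = P / a₂) (hd₃ : d₃ = -P / a₃)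
    (hc₁ : c₁ = a₁ * Real.sqrt ((a₁ - a₂) / (a₁ ^ 3 - ‖ψ 0‖ ^ 2)))
    (hc₂ : c₂ = a₂ * Real.sqrt ((a₁ - a₂) / (‖ψ 0‖ ^ 2 - a₂ ^ 3)))
    (hc₃ : c₃ = a₃ * Real.sqrt ((a₁ + a₃) / (‖ψ 0‖ ^ 2 + a₃ ^ 3))) :
    (∀ z, ψ z = ψ 0) ∧
    -- the canonical horizontal lift exists, has the explicit form, and is `4T`-periodic in `y`
    (∃ F, MinLag.IsCanonicalLift f u ψ lam F) ∧
    (∀ F, MinLag.IsCanonicalLift f u ψ lam F →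
      (∃ l₁ l₂ l₃ : Fin 3 → ℂ,
        MinLag.herm l₁ l₁ = 1 ∧ MinLag.herm l₂ l₂ = 1 ∧ MinLag.herm l₃ l₃ = 1 ∧
        MinLag.herm l₁ l₂ = 0 ∧ MinLag.herm l₁ l₃ = 0 ∧ MinLag.herm l₂ l₃ = 0 ∧
        MinLag.potentialD a₁ (ψ 0) lam *ᵥ l₁ = (Complex.I * d₁) • l₁ ∧
        MinLag.potentialD a₁ (ψ 0) lam *ᵥ l₂ = (Complex.I * d₂) • l₂ ∧
        MinLag.potentialD a₁ (ψ 0) lam *ᵥ l₃ = (Complex.I * d₃) • l₃ ∧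
        ∀ x y : ℝ, F (x + y * Complex.I) =
          (c₁ * MinLag.jacobiSn (r * y) k * Complex.exp (Complex.I * d₁ * x)) • l₁ +
          (c₂ * MinLag.jacobiCn (r * y) k * Complex.exp (Complex.I * d₂ * x)) • l₂ +
          (c₃ * MinLag.jacobiDn (r * y) k * Complex.exp (Complex.I * d₃ * x)) • l₃) ∧
      ∀ x y : ℝ, F (x + (y + 4 * T : ℝ) * Complex.I) = F (x + y * Complex.I)) ∧
    -- the surface is defined on the cylinder `ℂ / 4Tiℤ`
    0 < T ∧
    MinLag.DescendsTo f (AddSubgroup.zmultiples (4 * T * Complex.I : ℂ)) ∧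
    -- consequences of a nonzero real period `τ`
    (∀ τ : ℝ, τ ≠ 0 → (∀ x y : ℝ, f ((x + τ : ℝ) + y * Complex.I) = f (x + y * Complex.I)) →
      Complex.exp (Complex.I * d₁ * τ) = Complex.exp (Complex.I * d₂ * τ) ∧
      Complex.exp (Complex.I * d₂ * τ) = Complex.exp (Complex.I * d₃ * τ) ∧
      LinearIndependent ℝ ![(4 * T * Complex.I : ℂ), (τ : ℂ)] ∧
      MinLag.DescendsTo f (AddSubgroup.zmultiples (4 * T * Complex.I : ℂ) ⊔
        AddSubgroup.zmultiples (τ : ℂ))) ∧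
    -- real periods exist exactly when `d₁ / d₂` is rational
    ((∃ τ : ℝ, τ ≠ 0 ∧ ∀ x y : ℝ, f ((x + τ : ℝ) + y * Complex.I) = f (x + y * Complex.I)) ↔
      ∃ q : ℚ, d₁ / d₂ = q) := by
  obtain ⟨F₀, hF₀, hL⟩ := hf.exists_isMinimalLegendrian
  have hut := hequiv.conformalFactor_add hF₀ hL
  have hψP : ∀ z, ψ z = lam ^ 3 * P :=
    hP ▸ hL.eq_pow_mul_re (MinLag.ne_zero_of_norm_eq_one hlam) hreal
  have hP0 : P ≠ 0 := fun h0 => by simp [hψP, h0] at hψ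
  have hPsq : ‖ψ 0‖ ^ 2 = P ^ 2 := by simp [hψP, hlam]
  have H : MinLag.IsProfile a₁ a₂ a₃ P k r := .of_formula (ha₁ ▸ Real.exp_pos _) hP0
    (ha₁ ▸ hL.sq_lt_exp_pow_three hut hmax (by simp [hψP, hlam]) hflat) (hPsq ▸ hβ) ha₂ ha₃ hk hr
  rw [hPsq, ← H.amplitude_zero_eq] at hc₁
  rw [hPsq, ← H.amplitude_one_eq] at hc₂
  rw [hPsq, ← H.amplitude_two_eq] at hc₃
  subst hd₁ hd₂ hd₃ hc₁ hc₂ hc₃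
  have hrT : r * T = MinLag.ellipticK k := by rw [hT, mul_div_cancel₀ _ H.pos_r.ne']
  have hT0 : 0 < T := hT ▸ div_pos (MinLag.ellipticK_pos H.sq_k_lt_one) H.pos_r
  obtain ⟨F, hF⟩ := hL.exists_isCanonicalLift hlam hF₀
  have hJ := hF.isJacobiForm hlam hL hut hmax H ha₁ hψP
  have hT_le := AddSubgroup.zmultiples_le_of_mem (hF.mul_I_mem_periodSubgroup hJ H.sq_k_lt_one hrT)
  have hτ_iff := hF.ofReal_mem_periodSubgroup_iff_forall_exp_eq hJ H.sq_k_lt_one H.pos_r.ne'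
    fun j => (H.amplitude_pos j).ne'
  have hlin : ∀ τ : ℝ, τ ≠ 0 → LinearIndependent ℝ ![(4 * T * Complex.I : ℂ), (τ : ℂ)] := by
    exact_mod_cast fun τ => MinLag.linearIndependent_mul_I_ofReal (by positivity : 4 * T ≠ 0)
  simp only [← MinLag.ofReal_mem_periodSubgroup_iff]
  refine ⟨fun z => (hψP z).trans (hψP 0).symm, ⟨F, hF⟩, fun G hG => ?_, hT0,
    MinLag.descendsTo_of_le_periodSubgroup hT_le, fun τ hτ hper => ⟨(hτ_iff τ).1 hper 0 1,
      (hτ_iff τ).1 hper 1 2, hlin τ hτ, MinLag.descendsTo_of_le_periodSubgroup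
        (sup_le hT_le (AddSubgroup.zmultiples_le_of_mem hper))⟩, ?_⟩
  · have hl := hG.isJacobiForm hlam hL hut hmax H ha₁ hψP
    exact ⟨⟨_, _, _, hl.isHermOrthogonal 0 0, hl.isHermOrthogonal 1 1, hl.isHermOrthogonal 2 2,
      hl.isHermOrthogonal 0 1, hl.isHermOrthogonal 0 2, hl.isHermOrthogonal 1 2, hl.mulVec_eq 0,
      hl.mulVec_eq 1, hl.mulVec_eq 2, fun x y => (hl.expansion x y).trans (Fin.sum_univ_three _)⟩,
      hl.apply_add_four_mul H.sq_k_lt_one hrT⟩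
  · simp only [hτ_iff]
    exact MinLag.exists_forall_exp_I_mul_eq_iff H.sum_frequency (div_ne_zero hP0 H.pos₂.ne')
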